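/- A triangle $T$ \emph{tiles} into a triangle $R$ (the \emph{tile}) with $N$ tiles if $T$ is a union of $N$ triangles congruent to $R$ that overlap only at their boundaries. A triangle has \emph{incommensurable angles} if its angles are not all rational multiples of $\pi$. Let $T$ be a triangle with angles $(A,\,2A,\,\pi-3A)$ in some order, let these angles be incommensurable, and suppose that $\sqrt{3}\,\tan(A/2)\in\mathbb{Q}$. Put $t=\tan(A/2)/\sqrt{3}$. Then: (i) There is a triangle $R$ with angles $(\alpha,\beta,\gamma)$, where $\alpha=A$ and $\alpha+\beta=\pi/3$ (so $\gamma=2\pi/3$), such that $T$ tiles into $R$ with some finite number of tiles. (ii) For every tiling of $T$ into a triangle $R$ with such angles $(\alpha,\beta,\gamma)$, the number $N$ of tiles satisfies $$N=\frac{2}{3}\cdot\frac{3t^2-1}{(3t+1)(t-1)}\cdot r^2\quad\text{for some } r\in\mathbb{Q},$$ and $N$ is not a perfect square. -/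

import Mathlib

open scoped Congruent EuclideanGeometry

/-- The Euclidean plane. -/
abbrev Plane : Type := EuclideanSpace ℝ (Fin 2)

/-- A (nondegenerate) triangle in the Euclidean plane, with labelled vertices `T.points 0`,
`T.points 1`, `T.points 2`. -/
abbrev PlaneTriangle : Type := Affine.Triangle ℝ Plane

/-- The interior angle of `T` at its `i`-th vertex (indices are taken modulo 3). -/
noncomputable def PlaneTriangle.angleAt (T : PlaneTriangle) (i : Fin 3) : ℝ :=
  ∠ (T.points (i + 1)) (T.points i) (T.points (i + 2))

/-- The angles of `T` are `(a, b, c)`, in some order of the vertices. -/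
def PlaneTriangle.HasAngles (T : PlaneTriangle) (a b c : ℝ) : Prop :=
  ∃ σ : Equiv.Perm (Fin 3),
    PlaneTriangle.angleAt T (σ 0) = a ∧ PlaneTriangle.angleAt T (σ 1) = b ∧
      PlaneTriangle.angleAt T (σ 2) = c

/-- The angles of `T` are commensurable: all of them are rational multiples of `π`. -/
def PlaneTriangle.CommensurableAngles (T : PlaneTriangle) : Prop :=
  ∀ i : Fin 3, ∃ q : ℚ, PlaneTriangle.angleAt T i = (q : ℝ) * Real.pi

/-- `T` tiles into `R` with `N` tiles: the closed triangular region `T` is the union of `N`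
triangles congruent to `R` (reflections allowed) that overlap only at their boundaries.
The vertices of each tile `S i` are labelled so as to correspond to those of `R`. -/
def PlaneTriangle.TilesInto (T R : PlaneTriangle) (N : ℕ) : Prop :=
  ∃ S : Fin N → PlaneTriangle,
    (∀ i, (S i).points ≅ R.points) ∧
    (⋃ i, (S i).closedInterior) = T.closedInterior ∧
    ∀ i j, i ≠ j → Disjoint (S i).interior (S j).interior

/-! Write `t = p/q`. Since `A < π/3`, `3p < q`. The tile with angles `A`, `π/3 - A`, `2π/3` then has
sides proportional to the integers `a = 4pq`, `b = (q-3p)(q+p)`, `c = q² + 3p²`, where `c² = a² + ab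
+ b²`. By the law of sines the sides of `T` are proportional to `c²`, `(2b+a)c`, `3b(a+b)`, so tile
and target have explicit vertices in coordinates `u + vζ` with `ζ` a primitive sixth root of unity.

Existence (`exists_tiling`): a triangle similar to the tile with integer ratio `k` is tiled by `k²`
copies. An isosceles trapezoid with base angles `π/3` splits into three such triangles. Widened by
parallelograms and stacked, trapezoids form larger ones, three of which make a pinwheel filling an
equilateral triangle. A large enough multiple of the target is one equilateral triangle together
with four triangles similar to the tile (`isTileable_target`). All these dissections are checked as
identities between sums of crossing numbers of edges, which `tiling_of_sum_triIndicator` turns into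
tilings.

The count (`card_of_tiling`): in any tiling, the side of length `3b(a+b)` is covered by whole sides
of tiles, so it is an integer multiple of the scale of the tile, and that scale is rational relative
to the target. Comparing areas gives `N = 3(a+b)(a+2b)s² = 6(q+3p)(q-p)(q²-3p²)s²` with `s` rational
and nonzero, which is the claimed formula.

Not a square (`not_isSquare_of_eq`): with `m = q+3p` and `n = q-p`, a square `N` would make
`3mn(-m²+6mn+3n²)` a square. Coprimality and congruences modulo 3 reduce this to `b⁴ + 18b²k² - 27k⁴
= c²` (for new integers `b`, `k`, `c`), which `quartic_ne_sq` excludes by infinite descent. -/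

/-! ### Descent on a quartic equation. -/

/-- Coprime factors of `27 k⁴` are a fourth power and `27` times a fourth power. -/
theorem exists_fourth_powers_of_mul_eq {P Q k : ℕ} (hPQ : P.Coprime Q) (h : P * Q = 27 * k ^ 4) :
    ∃ x y : ℕ, x * y = k ∧ ((P = x ^ 4 ∧ Q = 27 * y ^ 4) ∨ (Q = x ^ 4 ∧ P = 27 * y ^ 4)) := by
  have key : ∀ {P Q : ℕ}, P.Coprime Q → P * Q = 27 * k ^ 4 → 3 ∣ Q →
      ∃ x y : ℕ, x * y = k ∧ P = x ^ 4 ∧ Q = 27 * y ^ 4 := by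
    intro P Q hPQ h h3
    have h3P : Nat.Coprime 3 P := (Nat.Coprime.coprime_dvd_right h3 hPQ).symm
    have h27 : 27 ∣ Q := by
      have : Nat.Coprime (3 ^ 3) P := h3P.pow_left 3
      exact (Nat.Coprime.dvd_of_dvd_mul_left this ⟨k ^ 4, by rw [h]⟩)
    obtain ⟨Q', rfl⟩ := h27
    have h' : P * Q' = k ^ 4 := by nlinarith
    have hc : P.Coprime Q' := Nat.Coprime.coprime_mul_left_right hPQ
    obtain ⟨x, hx⟩ := exists_eq_pow_of_mul_eq_pow (by simpa [Nat.isUnit_iff] using! hc) h'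
    obtain ⟨y, hy⟩ := exists_eq_pow_of_mul_eq_pow (a := Q') (b := P)
      (by simpa [Nat.isUnit_iff] using! hc.symm) (by rw [mul_comm]; exact h')
    refine ⟨x, y, ?_, hx, by rw [hy]⟩
    rw [hx, hy, ← mul_pow] at h'
    exact Nat.pow_left_injective (by norm_num : 4 ≠ 0) h'
  have h3 : 3 ∣ P * Q := ⟨9 * k ^ 4, by rw [h]; ring⟩
  rcases (Nat.Prime.dvd_mul Nat.prime_three).1 h3 with h3 | h3
  · obtain ⟨x, y, h1, h2, h4⟩ := key hPQ.symm (by rw [mul_comm]; exact h) h3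
    exact ⟨x, y, h1, Or.inr ⟨h2, h4⟩⟩
  · obtain ⟨x, y, h1, h2, h4⟩ := key hPQ h h3
    exact ⟨x, y, h1, Or.inl ⟨h2, h4⟩⟩

/-- Modulo 16 the quartic form is 8 if `b` and `k` are both odd, and 5 or 13 if only `k` is odd;
none of these is a square. -/
theorem even_right_of_quartic {b k c : ℤ} (hc : IsCoprime b k)
    (h : b ^ 4 + 18 * b ^ 2 * k ^ 2 - 27 * k ^ 4 = c ^ 2) : Odd b ∧ Even k := by
  have hz : ∀ z : ZMod 16, z ^ 2 ≠ 8 ∧ z ^ 2 ≠ 5 ∧ z ^ 2 ≠ 13 := by decide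
  have ho : ∀ z : ZMod 16, (2 * z + 1) ^ 2 = 1 ∨ (2 * z + 1) ^ 2 = 9 := by decide
  have he : ∀ z : ZMod 16, (2 * z) ^ 2 = 0 ∨ (2 * z) ^ 2 = 4 := by decide
  have h16 : ((b : ZMod 16) ^ 2) ^ 2 + 18 * (b : ZMod 16) ^ 2 * (k : ZMod 16) ^ 2
      - 27 * ((k : ZMod 16) ^ 2) ^ 2 = (c : ZMod 16) ^ 2 := by
    have := congrArg (Int.cast : ℤ → ZMod 16) h
    push_cast at this
    rw [← this]; ring
  obtain ⟨z1, z2, z3⟩ := hz (c : ZMod 16)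
  rcases Int.even_or_odd b with hb | hb <;> rcases Int.even_or_odd k with hk | hk
  · exfalso
    have := hc.isUnit_of_dvd' hb.two_dvd hk.two_dvd
    rw [Int.isUnit_iff] at this
    omega
  · exfalso
    obtain ⟨i, rfl⟩ := hb
    obtain ⟨j, rfl⟩ := hk
    push_cast at h16
    rw [← two_mul (i : ZMod 16)] at h16
    rcases he i with h1 | h1 <;> rcases ho j with h2 | h2 <;> rw [h1, h2] at h16 <;>
      first | exact z2 (h16.symm.trans (by decide)) | exact z3 (h16.symm.trans (by decide))
  · exact ⟨hb, hk⟩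
  · exfalso
    obtain ⟨i, rfl⟩ := hb
    obtain ⟨j, rfl⟩ := hk
    push_cast at h16
    rcases ho i with h1 | h1 <;> rcases ho j with h2 | h2 <;> rw [h1, h2] at h16 <;>
      exact z1 (h16.symm.trans (by decide))

/-- Two naturals with sum `s`, difference `d` and product `27 k⁴`, where `s` and `d` have no common
prime factor with `3 k`. -/
theorem exists_coprime_factors {s d : ℤ} {k : ℕ} (hk : 0 < k) (hs : 0 < s) (hpar : Even (s + d))
    (h : s ^ 2 - d ^ 2 = 108 * (k : ℤ) ^ 4) (h3 : ¬ (3 ∣ s ∧ 3 ∣ d))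
    (hco : ∀ p : ℕ, p.Prime → p ∣ k → ¬ ((p : ℤ) ∣ s ∧ (p : ℤ) ∣ d)) :
    ∃ P Q : ℕ, P.Coprime Q ∧ P * Q = 27 * k ^ 4 ∧ (P : ℤ) + Q = s ∧ (Q : ℤ) - P = d := by
  obtain ⟨Q, hQ⟩ := hpar
  have hPQ : (s - Q) * Q = 27 * (k : ℤ) ^ 4 := by
    have hd : d = 2 * Q - s := by linarith
    subst hd
    linarith
  have hpos : 0 < (s - Q) * Q := by rw [hPQ]; positivity
  have hQ0 : 0 < Q := by
    by_contra hq
    push Not at hq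
    have : 0 < s - Q := by linarith
    nlinarith
  have hP0 : 0 < s - Q := by
    by_contra hq
    push Not at hq
    nlinarith
  lift Q to ℕ using hQ0.le
  obtain ⟨P, hP⟩ := Int.eq_ofNat_of_zero_le hP0.le
  refine ⟨P, Q, ?_, ?_, by linarith, by linarith⟩
  · refine Nat.coprime_of_dvd fun p hp hpP hpQ => ?_
    have h1 : (p : ℤ) ∣ P := by exact_mod_cast hpP
    have h2 : (p : ℤ) ∣ Q := by exact_mod_cast hpQ
    have hps : (p : ℤ) ∣ s := by
      have : s = P + Q := by linarith
      rw [this]; exact dvd_add h1 h2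
    have hpd : (p : ℤ) ∣ d := by
      have : d = Q - P := by linarith
      rw [this]; exact dvd_sub h2 h1
    have hk4 : p ∣ 27 * k ^ 4 := by
      have : ((27 * k ^ 4 : ℕ) : ℤ) = P * Q := by rw [← hP]; push_cast; linarith
      have h' : (p : ℤ) ∣ ((27 * k ^ 4 : ℕ) : ℤ) := by rw [this]; exact h1.mul_right _
      exact_mod_cast h'
    rcases hp.dvd_mul.1 hk4 with h27 | h27
    · have : p ∣ 3 := hp.dvd_of_dvd_pow (n := 3) (by norm_num; exact h27)
      have : p = 3 := (Nat.prime_dvd_prime_iff_eq hp Nat.prime_three).1 this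
      subst this
      exact h3 ⟨by exact_mod_cast hps, by exact_mod_cast hpd⟩
    · exact hco p hp (hp.dvd_of_dvd_pow h27) ⟨hps, hpd⟩
  · have : ((P * Q : ℕ) : ℤ) = ((27 * k ^ 4 : ℕ) : ℤ) := by push_cast; rw [← hP]; exact hPQ
    exact_mod_cast this

theorem Int.sq_emod_three (z : ℤ) (hz : ¬ 3 ∣ z) : z ^ 2 % 3 = 1 := by
  have h : z % 3 = 1 ∨ z % 3 = 2 := by omega
  rcases h with h | h <;> rw [sq, Int.mul_emod, h] <;> rfl

/-- Infinite descent on `k`. Completing the square and factoring a difference of squares leads to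
`x⁴ - 9x²y² + 27y⁴ = b²` with `k = xy`; doing the same to this equation returns to the original
quartic with a smaller `k`. -/
theorem quartic_ne_sq (k : ℕ) : ∀ (b : ℕ) (c : ℤ), 0 < k → b.Coprime k → ¬ 3 ∣ b →
    (b : ℤ) ^ 4 + 18 * b ^ 2 * k ^ 2 - 27 * k ^ 4 ≠ c ^ 2 := by
  induction k using Nat.strong_induction_on with
  | _ k ih =>
  intro b c hk hbk h3 h
  obtain ⟨hb, hke⟩ := even_right_of_quartic (Nat.isCoprime_iff_coprime.2 hbk) h
  have h3' : ¬ (3 : ℤ) ∣ b := by exact_mod_cast h3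
  have hb0 : 0 < b := by
    rcases Nat.eq_zero_or_pos b with rfl | h0
    · simp at h3
    · exact h0
  have hsq : ((b : ℤ) ^ 2 + 9 * k ^ 2) ^ 2 - c ^ 2 = 108 * (k : ℤ) ^ 4 := by rw [← h]; ring
  have hpar : Even ((b : ℤ) ^ 2 + 9 * k ^ 2 + c) := by
    have h1 : Odd (c ^ 2) := by
      rw [← h]
      have e1 : Odd ((b : ℤ) ^ 4) := hb.pow
      have e2 : Even (18 * (b : ℤ) ^ 2 * k ^ 2) := ⟨9 * (b : ℤ) ^ 2 * k ^ 2, by ring⟩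
      have e3 : Even (27 * (k : ℤ) ^ 4) := (hke.pow_of_ne_zero (by norm_num)).mul_left 27
      exact (e1.add_even e2).sub_even e3
    have h2 : Odd c := by
      rcases Int.even_or_odd c with h | h
      · exact absurd (h.pow_of_ne_zero (n := 2) (by norm_num)) (by simpa using h1)
      · exact h
    have e3 : Even (9 * (k : ℤ) ^ 2) := (hke.pow_of_ne_zero (by norm_num)).mul_left 9
    exact ((hb.pow (n := 2)).add_even e3).add_odd h2
  obtain ⟨P, Q, hPQ, hmul, hsum, -⟩ := exists_coprime_factors hk (by positivity) hpar hsq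
    (fun hh => h3' (Int.prime_three.dvd_of_dvd_pow
      ((dvd_add_left (Dvd.dvd.mul_right (by norm_num) _)).1 hh.1)))
    (fun p hp hpk hh => by
      have hpk' : (p : ℤ) ∣ k := by exact_mod_cast hpk
      have : (p : ℤ) ∣ b ^ 2 :=
        (dvd_add_left (Dvd.dvd.mul_left (hpk'.trans (dvd_pow_self _ (by norm_num))) _)).1 hh.1
      have : (p : ℤ) ∣ b := (Nat.prime_iff_prime_int.1 hp).dvd_of_dvd_pow this
      exact Nat.not_coprime_of_dvd_of_dvd hp.one_lt (by exact_mod_cast this) hpk hbk)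
  -- The coprime factors with product `27k⁴` are `x⁴` and `27y⁴` in some order; only their sum `b² +
  -- 9k²` is needed, so the order does not matter.
  have hxy : ∃ x y : ℕ, x * y = k ∧ x.Coprime y ∧
      (x : ℤ) ^ 4 + 27 * y ^ 4 = (b : ℤ) ^ 2 + 9 * k ^ 2 := by
    obtain ⟨x, y, hk', ⟨rfl, rfl⟩ | ⟨rfl, rfl⟩⟩ := exists_fourth_powers_of_mul_eq hPQ hmul
    · refine ⟨x, y, hk', ?_, by rw [← hsum]; push_cast; ring⟩
      exact (Nat.coprime_pow_left_iff (by norm_num) _ _).1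
        ((Nat.coprime_pow_right_iff (by norm_num : 0 < 4) _ _).1
          (Nat.Coprime.coprime_mul_left_right hPQ))
    · refine ⟨x, y, hk', ?_, by rw [← hsum]; push_cast; ring⟩
      exact (Nat.coprime_pow_left_iff (by norm_num) _ _).1
        ((Nat.coprime_pow_right_iff (by norm_num : 0 < 4) _ _).1
          (Nat.Coprime.coprime_mul_left_right hPQ.symm))
  obtain ⟨x, y, rfl, hxyc, he⟩ := hxy
  have hx0 : 0 < x := Nat.pos_of_mul_pos_right hk
  have hy0 : 0 < y := Nat.pos_of_mul_pos_left hk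
  have he' : (x : ℤ) ^ 4 + 27 * y ^ 4 - 9 * x ^ 2 * y ^ 2 = (b : ℤ) ^ 2 := by
    push_cast at he; linear_combination he
  have h3x : ¬ (3 : ℤ) ∣ x := fun hx => h3' (Int.prime_three.dvd_of_dvd_pow (n := 2) (by
    rw [← he']
    obtain ⟨w, hw⟩ := hx
    exact ⟨27 * w ^ 4 + 9 * y ^ 4 - 27 * w ^ 2 * y ^ 2, by rw [hw]; ring⟩))
  -- If `y` were odd, then `x` would be even and `b² ≡ 27y⁴ ≡ 3` modulo 4.
  have hye : Even y := by
    by_contra hyo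
    rw [Nat.not_even_iff_odd] at hyo
    have hxe : Even x := by
      push_cast at hke
      rcases Int.even_mul.1 hke with h | h
      · exact_mod_cast h
      · exact absurd (by exact_mod_cast h) (Nat.not_even_iff_odd.2 hyo)
    obtain ⟨i, rfl⟩ := hxe
    obtain ⟨j, rfl⟩ := hyo
    obtain ⟨l, hl⟩ := hb
    rw [hl] at he'
    push_cast at he'
    have : (4 : ℤ) ∣ 2 := ⟨l ^ 2 + l - (4 * i ^ 4 + 27 * (4 * j ^ 4 + 8 * j ^ 3 + 6 * j ^ 2 + 2 * j)
      - 9 * i ^ 2 * (2 * j + 1) ^ 2) - 6, by linear_combination he'⟩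
    norm_num at this
  obtain ⟨w, rfl⟩ := hye
  have hw0 : 0 < w := by omega
  -- Second difference of squares, from completing the square in `x²` after `y = 2w`.
  have hsq2 : (b : ℤ) ^ 2 - (x ^ 2 - 18 * w ^ 2) ^ 2 = 108 * (w : ℤ) ^ 4 := by
    rw [← he']; push_cast; ring
  have hxo : Odd x := by
    rcases Nat.even_or_odd x with h | h
    · exact absurd hxyc (Nat.not_coprime_of_dvd_of_dvd one_lt_two h.two_dvd ⟨w, by ring⟩)
    · exact h
  have hxo' : Odd (x : ℤ) := by exact_mod_cast hxo
  have hpar2 : Even ((b : ℤ) + (x ^ 2 - 18 * w ^ 2)) :=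
    hb.add_odd ((hxo'.pow (n := 2)).sub_even ⟨9 * (w : ℤ) ^ 2, by ring⟩)
  obtain ⟨P, Q, hPQ, hmul, -,
      hdiff⟩ := exists_coprime_factors hw0 (by exact_mod_cast hb0) hpar2 hsq2
    (fun hh => h3' hh.1)
    (fun p hp hpw hh => by
      have hpw' : (p : ℤ) ∣ w := by exact_mod_cast hpw
      have : (p : ℤ) ∣ x ^ 2 :=
        (dvd_sub_left (Dvd.dvd.mul_left (hpw'.trans (dvd_pow_self _ (by norm_num))) _)).1 hh.2
      have : (p : ℤ) ∣ x := (Nat.prime_iff_prime_int.1 hp).dvd_of_dvd_pow this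
      exact Nat.not_coprime_of_dvd_of_dvd hp.one_lt (by exact_mod_cast this)
        (hpw.trans ⟨2, by ring⟩) hxyc)
  -- Now the order matters: one order gives `x² ≡ -r⁴` modulo 3, which is impossible, and the other
  -- is the original equation for `(r, s, x)`, where `k = 2xrs`.
  obtain ⟨r, s, rfl, ⟨rfl, rfl⟩ | ⟨rfl, rfl⟩⟩ := exists_fourth_powers_of_mul_eq hPQ hmul
  · push_cast at hdiff
    have h1 := Int.sq_emod_three x h3x
    have h2 : (x : ℤ) ^ 2 = 3 * (9 * s ^ 4 + 6 * (r * s) ^ 2) - (r ^ 2) ^ 2 := by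
      linear_combination -hdiff
    by_cases hr : (3 : ℤ) ∣ (r : ℤ) ^ 2
    · obtain ⟨v, hv⟩ := hr
      have : (x : ℤ) ^ 2 = 3 * (9 * s ^ 4 + 6 * (r * s) ^ 2 - 3 * v ^ 2) := by
        rw [h2, hv]; ring
      omega
    · have := Int.sq_emod_three _ hr
      omega
  · have hs0 : 0 < s := Nat.pos_of_mul_pos_left hw0
    have hr0 : 0 < r := Nat.pos_of_mul_pos_right hw0
    refine ih s ?_ r x hs0 ?_ ?_ ?_
    · calc s < s + s := by omega
        _ = 1 * (1 * s + 1 * s) := by ring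
        _ ≤ x * (r * s + r * s) := by gcongr <;> omega
    · exact (Nat.coprime_pow_left_iff (by norm_num) _ _).1
        ((Nat.coprime_pow_right_iff (by norm_num : 0 < 4) _ _).1
          (Nat.Coprime.coprime_mul_left_right hPQ.symm))
    · intro hr
      exact Nat.not_coprime_of_dvd_of_dvd (by norm_num : 1 < 3) (Dvd.dvd.mul_right (by norm_num) _)
        (hr.trans (dvd_pow_self _ (by norm_num))) hPQ
    · push_cast at hdiff ⊢
      linear_combination hdiff

theorem Int.eq_sq_of_isCoprime {x y z : ℤ} (hx : 0 < x) (hc : IsCoprime x y) (h : x * y = z ^ 2) :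
    ∃ w, x = w ^ 2 := by
  obtain ⟨w, hw | hw⟩ := Int.sq_of_isCoprime hc h
  · exact ⟨w, hw⟩
  · nlinarith [sq_nonneg w]

/-- If `3 ∤ m`, the quadratic factor is coprime to `3mn`, hence a square, yet it is `-m²` modulo 3.
If `3 ∣ m`, cancelling 9 leaves the pairwise coprime factors `m`, `n` and `G`, all squares;
substituting `m = 9k²` and `n = b²` turns `G = g²` into the quartic. -/
theorem three_mul_quartic_ne_sq_of_coprime {m n z : ℤ} (hm : 0 < m) (hn : 0 < n)
    (hmn : IsCoprime m n) (hF : 0 < -m ^ 2 + 6 * m * n + 3 * n ^ 2) :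
    3 * m * n * (-m ^ 2 + 6 * m * n + 3 * n ^ 2) ≠ z ^ 2 := by
  intro h
  have hp3 : Prime (3 : ℤ) := Int.prime_three
  by_cases h3 : (3 : ℤ) ∣ m
  · obtain ⟨m, rfl⟩ := h3
    have hm' : 0 < m := by linarith
    have h3n : IsCoprime 3 n := hmn.of_mul_left_left
    have hmn' : IsCoprime m n := hmn.of_mul_left_right
    have hz3 : (3 : ℤ) ∣ z := hp3.dvd_of_dvd_pow (n := 2) (by
      rw [← h]; exact ⟨3 * m * n * (-(3 * m) ^ 2 + 6 * (3 * m) * n + 3 * n ^ 2), by ring⟩)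
    obtain ⟨z, rfl⟩ := hz3
    set G := -3 * m ^ 2 + 6 * m * n + n ^ 2 with hG
    have hG0 : 0 < G := by
      have : -(3 * m) ^ 2 + 6 * (3 * m) * n + 3 * n ^ 2 = 3 * G := by rw [hG]; ring
      linarith
    have hz : 3 * m * n * G = z ^ 2 := by
      have : 9 * (3 * m * n * G) = 9 * z ^ 2 := by rw [hG]; linear_combination h
      linarith
    have hnG : IsCoprime n G := by
      have : IsCoprime n (-3 * m ^ 2 + n * (6 * m + n)) :=
        (((h3n.symm.neg_right).mul_right (hmn'.symm.pow_right (n := 2)))).add_mul_left_right _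
      convert! this using 1; rw [hG]; ring
    have hmG : IsCoprime m G := by
      have : IsCoprime m (n ^ 2 + m * (-3 * m + 6 * n)) :=
        (hmn'.pow_right (n := 2)).add_mul_left_right _
      convert! this using 1; rw [hG]; ring
    have h3G : IsCoprime 3 G := by
      have : IsCoprime 3 (n ^ 2 + 3 * (-m ^ 2 + 2 * m * n)) :=
        (h3n.pow_right (n := 2)).add_mul_left_right _
      convert! this using 1; rw [hG]; ring
    obtain ⟨b, hb⟩ := Int.eq_sq_of_isCoprime hn (y := 3 * m * G) (z := z)
      ((h3n.symm.mul_right hmn'.symm).mul_right hnG) (by linear_combination hz)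
    obtain ⟨g, hg⟩ := Int.eq_sq_of_isCoprime hG0 (y := 3 * m * n) (z := z)
      ((h3G.symm.mul_right hmG.symm).mul_right hnG.symm) (by linear_combination hz)
    obtain ⟨d, hd⟩ := Int.eq_sq_of_isCoprime hm (y := n * G) (z := z)
      ((h3n.mul_left hmn').mul_right (h3G.mul_left hmG)) (by linear_combination hz)
    have h3d : (3 : ℤ) ∣ d := hp3.dvd_of_dvd_pow (n := 2) ⟨m, hd.symm⟩
    obtain ⟨k, rfl⟩ := h3d
    have hmk : m = 3 * k ^ 2 := by linarith
    have hk0 : k ≠ 0 := by rintro rfl; simp [hmk] at hm'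
    refine quartic_ne_sq k.natAbs b.natAbs g (Int.natAbs_pos.2 hk0) ?_ ?_ ?_
    · rw [hmk, hb] at hmn'
      exact Int.isCoprime_iff_gcd_eq_one.1
        ((IsCoprime.pow_iff two_pos two_pos).1 hmn'.of_mul_left_right).symm
    · intro h3b
      have h3b' : (3 : ℤ) ∣ b := Int.natCast_dvd.2 h3b
      have : (3 : ℤ) ∣ n := by rw [hb]; exact h3b'.trans (dvd_pow_self _ (by norm_num))
      exact hp3.not_isUnit (h3n.isUnit_of_dvd' dvd_rfl this)
    · have e1 : ((b.natAbs : ℤ)) ^ 2 = b ^ 2 := Int.natAbs_sq b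
      have e2 : ((k.natAbs : ℤ)) ^ 2 = k ^ 2 := Int.natAbs_sq k
      have e3 : ((b.natAbs : ℤ)) ^ 4 = (b ^ 2) ^ 2 := by rw [← e1]; ring
      have e4 : ((k.natAbs : ℤ)) ^ 4 = (k ^ 2) ^ 2 := by rw [← e2]; ring
      rw [e3, e4, e1, e2, ← hg, hG, hmk, hb]; ring
  · set F := -m ^ 2 + 6 * m * n + 3 * n ^ 2 with hFd
    have h3m : IsCoprime 3 m := (Prime.coprime_iff_not_dvd hp3).2 h3
    have hnF : IsCoprime n F := by
      have : IsCoprime n (-m ^ 2 + n * (6 * m + 3 * n)) :=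
        ((hmn.symm.pow_right (n := 2)).neg_right).add_mul_left_right _
      convert! this using 1; rw [hFd]; ring
    have hmF : IsCoprime m F := by
      have : IsCoprime m (3 * n ^ 2 + m * (-m + 6 * n)) :=
        (h3m.symm.mul_right (hmn.pow_right (n := 2))).add_mul_left_right _
      convert! this using 1; rw [hFd]; ring
    have h3F : IsCoprime 3 F := by
      have : IsCoprime 3 (-m ^ 2 + 3 * (2 * m * n + n ^ 2)) :=
        ((h3m.pow_right (n := 2)).neg_right).add_mul_left_right _
      convert! this using 1; rw [hFd]; ring
    obtain ⟨f, hf⟩ := Int.eq_sq_of_isCoprime hF (y := 3 * m * n) (z := z)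
      ((h3F.symm.mul_right hmF.symm).mul_right hnF.symm) (by linear_combination h)
    have h1 := Int.sq_emod_three m h3
    have h2 : f ^ 2 = 3 * (2 * m * n + n ^ 2) - m ^ 2 := by rw [← hf, hFd]; ring
    by_cases h3f : (3 : ℤ) ∣ f
    · obtain ⟨v, rfl⟩ := h3f
      have : (3 * v) ^ 2 = 3 * (3 * v ^ 2) := by ring
      omega
    · have := Int.sq_emod_three f h3f
      omega

theorem not_isSquare_three_mul_quartic {m n : ℤ} (hm : 0 < m) (hn : 0 < n)
    (hF : 0 < -m ^ 2 + 6 * m * n + 3 * n ^ 2) :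
    ¬ IsSquare (3 * m * n * (-m ^ 2 + 6 * m * n + 3 * n ^ 2)) := by
  rintro ⟨z, hz⟩
  obtain ⟨m', n', hc, hm', hn'⟩ := Int.exists_gcd_one (m := m) (n := n)
    (Int.gcd_pos_of_ne_zero_left _ hm.ne')
  have hg : 0 < (Int.gcd m n : ℤ) := by exact_mod_cast Int.gcd_pos_of_ne_zero_left _ hm.ne'
  generalize (Int.gcd m n : ℤ) = g at hm' hn' hg
  subst hm' hn'
  -- The form is homogeneous of degree 4, so dividing `m` and `n` by their gcd `g` removes the
  -- square factor `g⁴`.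
  have hdvd : (g ^ 2) ^ 2 ∣ z ^ 2 :=
    ⟨3 * m' * n' * (-m' ^ 2 + 6 * m' * n' + 3 * n' ^ 2), by linear_combination -hz⟩
  obtain ⟨w, rfl⟩ := (Int.pow_dvd_pow_iff two_ne_zero).1 hdvd
  refine three_mul_quartic_ne_sq_of_coprime (z := w) (pos_of_mul_pos_left hm hg.le)
    (pos_of_mul_pos_left hn hg.le) (Int.isCoprime_iff_gcd_eq_one.2 hc) ?_ ?_
  · refine pos_of_mul_pos_left (b := g ^ 2) ?_ (by positivity)
    linarith
  · have hg4 : g ^ 4 ≠ 0 := by positivity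
    apply mul_left_cancel₀ hg4
    linear_combination hz

/-! ### Crossing numbers and indicator functions of triangles. -/

/-- Twice the signed area of the triangle `P Q X` in the coordinate plane. -/
def signedArea (P Q X : ℝ × ℝ) : ℝ := (Q.1 - P.1) * (X.2 - P.2) - (Q.2 - P.2) * (X.1 - P.1)

open Classical in
/-- The signed crossing number of the edge from `P` to `Q` with the upward vertical ray at `X`. -/
noncomputable def edgeCrossing (P Q X : ℝ × ℝ) : ℤ :=
  if P.1 ≤ X.1 ∧ X.1 < Q.1 ∧ signedArea P Q X < 0 then -1
  else if Q.1 ≤ X.1 ∧ X.1 < P.1 ∧ 0 < signedArea P Q X then 1 else 0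

/-- The signed indicator function of the (half-open) triangle `P Q S`. -/
noncomputable def triIndicator (P Q S : ℝ × ℝ) : ℝ × ℝ → ℤ :=
  fun X => edgeCrossing P Q X + edgeCrossing Q S X + edgeCrossing S P X

def openTriangle (P Q S : ℝ × ℝ) : Set (ℝ × ℝ) :=
  {X | 0 < signedArea Q S X ∧ 0 < signedArea S P X ∧ 0 < signedArea P Q X}

def closedTriangle (P Q S : ℝ × ℝ) : Set (ℝ × ℝ) :=
  {X | 0 ≤ signedArea Q S X ∧ 0 ≤ signedArea S P X ∧ 0 ≤ signedArea P Q X}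

theorem signedArea_swap (P Q X : ℝ × ℝ) : signedArea Q P X = -signedArea P Q X := by
  simp only [signedArea]; ring

theorem signedArea_rotate (P Q X : ℝ × ℝ) : signedArea Q X P = signedArea P Q X := by
  simp only [signedArea]; ring

theorem signedArea_sum (P Q S X : ℝ × ℝ) :
    signedArea Q S X + signedArea S P X + signedArea P Q X = signedArea P Q S := by
  simp only [signedArea]; ring

theorem signedArea_barycentric (P Q S X : ℝ × ℝ) :
    signedArea Q S X * (P.1 - X.1) + signedArea S P X * (Q.1 - X.1)
      + signedArea P Q X * (S.1 - X.1) = 0 := by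
  simp only [signedArea]; ring

theorem edgeCrossing_swap (P Q X : ℝ × ℝ) : edgeCrossing Q P X = -edgeCrossing P Q X := by
  unfold edgeCrossing
  rw [signedArea_swap]
  split_ifs <;> grind

theorem triIndicator_rotate (P Q S : ℝ × ℝ) : triIndicator Q S P = triIndicator P Q S := by
  funext X; simp only [triIndicator]; ring

/-- To prove a statement about a triangle and a point that is invariant under rotation of the
vertices, distinguish how the vertical line through the point separates the vertices. -/
theorem separation_cases {X : ℝ × ℝ} {C : ℝ × ℝ → ℝ × ℝ → ℝ × ℝ → Prop}
    (rot : ∀ P Q S, C P Q S → C Q S P)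
    (hleft : ∀ P Q S : ℝ × ℝ, P.1 ≤ X.1 → Q.1 ≤ X.1 → S.1 ≤ X.1 → C P Q S)
    (hright : ∀ P Q S : ℝ × ℝ, X.1 < P.1 → X.1 < Q.1 → X.1 < S.1 → C P Q S)
    (hone : ∀ P Q S : ℝ × ℝ, P.1 ≤ X.1 → X.1 < Q.1 → X.1 < S.1 → C P Q S)
    (htwo : ∀ P Q S : ℝ × ℝ, X.1 < P.1 → Q.1 ≤ X.1 → S.1 ≤ X.1 → C P Q S)
    (P Q S : ℝ × ℝ) : C P Q S := by
  rcases le_or_gt P.1 X.1 with hP | hP <;> rcases le_or_gt Q.1 X.1 with hQ | hQ <;>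
    rcases le_or_gt S.1 X.1 with hS | hS
  · exact hleft _ _ _ hP hQ hS
  · exact rot _ _ _ (htwo _ _ _ hS hP hQ)
  · exact rot _ _ _ (rot _ _ _ (htwo _ _ _ hQ hS hP))
  · exact hone _ _ _ hP hQ hS
  · exact htwo _ _ _ hP hQ hS
  · exact rot _ _ _ (rot _ _ _ (hone _ _ _ hQ hS hP))
  · exact rot _ _ _ (hone _ _ _ hS hP hQ)
  · exact hright _ _ _ hP hQ hS

theorem edgeCrossing_of_le_of_le {P Q X : ℝ × ℝ} (hP : P.1 ≤ X.1) (hQ : Q.1 ≤ X.1) :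
    edgeCrossing P Q X = 0 := by
  simp [edgeCrossing, hP.not_gt, hQ.not_gt]

theorem edgeCrossing_of_lt_of_lt {P Q X : ℝ × ℝ} (hP : X.1 < P.1) (hQ : X.1 < Q.1) :
    edgeCrossing P Q X = 0 := by
  simp [edgeCrossing, hP.not_ge, hQ.not_ge]

open Classical in
theorem edgeCrossing_of_le_of_lt {P Q X : ℝ × ℝ} (hP : P.1 ≤ X.1) (hQ : X.1 < Q.1) :
    edgeCrossing P Q X = if signedArea P Q X < 0 then -1 else 0 := by
  simp [edgeCrossing, hP, hP.not_gt, hQ]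

open Classical in
theorem edgeCrossing_of_lt_of_le {P Q X : ℝ × ℝ} (hP : X.1 < P.1) (hQ : Q.1 ≤ X.1) :
    edgeCrossing P Q X = if 0 < signedArea P Q X then 1 else 0 := by
  simp [edgeCrossing, hP, hP.not_ge, hQ]

/-- The half-open convention in `edgeCrossing` makes this exact at every point, including edges and
vertices. It is the source of `edgeCrossing_add`. -/
theorem triIndicator_of_collinear {P Q S : ℝ × ℝ} (h : signedArea P Q S = 0) :
    triIndicator P Q S = 0 := by
  funext X
  revert h
  refine separation_cases (X := X)
    (C := fun P Q S => signedArea P Q S = 0 → triIndicator P Q S X = (0 : ℝ × ℝ → ℤ) X)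
    ?_ ?_ ?_ ?_ ?_ P Q S
  · intro P Q S h h'
    rw [triIndicator_rotate]
    exact h (by rw [← h', signedArea_rotate P Q S])
  · intro P Q S hP hQ hS _
    simp [triIndicator, edgeCrossing_of_le_of_le, *]
  · intro P Q S hP hQ hS _
    simp [triIndicator, edgeCrossing_of_lt_of_lt, *]
  · intro P Q S hP hQ hS h
    have h1 := signedArea_sum P Q S X
    have h2 := signedArea_barycentric P Q S X
    rw [h] at h1
    have h3 : signedArea S P X * (Q.1 - P.1) + signedArea P Q X * (S.1 - P.1) = 0 := by
      linear_combination h2 - (P.1 - X.1) * h1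
    have hQ' : 0 < Q.1 - P.1 := by linarith
    have hS' : 0 < S.1 - P.1 := by linarith
    simp only [triIndicator, edgeCrossing_of_le_of_lt hP hQ, edgeCrossing_of_lt_of_lt hQ hS,
      edgeCrossing_of_lt_of_le hS hP]
    split_ifs with h4 h5 h5
    · simp
    · nlinarith
    · nlinarith
    · simp
  · intro P Q S hP hQ hS h
    have h1 := signedArea_sum P Q S X
    have h2 := signedArea_barycentric P Q S X
    rw [h] at h1
    have h3 : signedArea S P X * (P.1 - Q.1) + signedArea P Q X * (P.1 - S.1) = 0 := by
      linear_combination -h2 + (P.1 - X.1) * h1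
    have hQ' : 0 < P.1 - Q.1 := by linarith
    have hS' : 0 < P.1 - S.1 := by linarith
    simp only [triIndicator, edgeCrossing_of_le_of_lt hS hP, edgeCrossing_of_le_of_le hQ hS,
      edgeCrossing_of_lt_of_le hP hQ]
    split_ifs with h4 h5 h5
    · simp
    · nlinarith
    · nlinarith
    · simp

/-- Which boundary points are counted is left open: lying between the open and the closed triangle
suffices, since closures recover the rest. -/
theorem triIndicator_spec {P Q S : ℝ × ℝ} (h : 0 < signedArea P Q S) (X : ℝ × ℝ) :
    (X ∈ openTriangle P Q S → triIndicator P Q S X = 1) ∧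
    (triIndicator P Q S X = 0 ∨ triIndicator P Q S X = 1 ∧ X ∈ closedTriangle P Q S) := by
  revert h
  refine separation_cases (X := X)
    (C := fun P Q S => 0 < signedArea P Q S →
      (X ∈ openTriangle P Q S → triIndicator P Q S X = 1) ∧
      (triIndicator P Q S X = 0 ∨ triIndicator P Q S X = 1 ∧ X ∈ closedTriangle P Q S))
    ?_ ?_ ?_ ?_ ?_ P Q S
  · intro P Q S h h'
    rw [triIndicator_rotate]
    obtain ⟨h1, h2⟩ := h (by rwa [signedArea_rotate P Q S] at h')
    refine ⟨fun hx => h1 ⟨hx.2.2, hx.1, hx.2.1⟩, h2.imp_right fun hx => ⟨hx.1, ?_⟩⟩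
    exact ⟨hx.2.2.1, hx.2.2.2, hx.2.1⟩
  · intro P Q S hP hQ hS h
    refine ⟨fun ⟨h1, h2, h3⟩ => ?_, Or.inl ?_⟩
    · exfalso
      have hb := signedArea_barycentric P Q S X
      have a1 := mul_nonpos_of_nonneg_of_nonpos h1.le (sub_nonpos.2 hP)
      have a2 := mul_nonpos_of_nonneg_of_nonpos h2.le (sub_nonpos.2 hQ)
      have a3 := mul_nonpos_of_nonneg_of_nonpos h3.le (sub_nonpos.2 hS)
      have b1 : P.1 - X.1 = 0 :=
        (mul_eq_zero.1 (by linarith : signedArea Q S X * (P.1 - X.1) = 0)).resolve_left h1.ne'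
      have b2 : Q.1 - X.1 = 0 :=
        (mul_eq_zero.1 (by linarith : signedArea S P X * (Q.1 - X.1) = 0)).resolve_left h2.ne'
      have b3 : S.1 - X.1 = 0 :=
        (mul_eq_zero.1 (by linarith : signedArea P Q X * (S.1 - X.1) = 0)).resolve_left h3.ne'
      have : signedArea P Q S = 0 := by
        simp only [signedArea]
        rw [show Q.1 - P.1 = 0 by linarith, show S.1 - P.1 = 0 by linarith]; ring
      linarith
    · simp [triIndicator, edgeCrossing_of_le_of_le, *]
  · intro P Q S hP hQ hS h
    refine ⟨fun ⟨h1, h2, h3⟩ => ?_, Or.inl ?_⟩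
    · exfalso
      have hb := signedArea_barycentric P Q S X
      have a1 := mul_pos h1 (sub_pos.2 hP)
      have a2 := mul_pos h2 (sub_pos.2 hQ)
      have a3 := mul_pos h3 (sub_pos.2 hS)
      linarith
    · simp [triIndicator, edgeCrossing_of_lt_of_lt, *]
  · intro P Q S hP hQ hS h
    have h1 := signedArea_sum P Q S X
    have h2 := signedArea_barycentric P Q S X
    have hQ' : 0 < Q.1 - X.1 := by linarith
    have hS' : 0 < S.1 - X.1 := by linarith
    have hP' : 0 ≤ X.1 - P.1 := by linarith
    simp only [triIndicator, edgeCrossing_of_le_of_lt hP hQ, edgeCrossing_of_lt_of_lt hQ hS,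
      edgeCrossing_of_lt_of_le hS hP]
    refine ⟨fun ⟨h3, h4, h5⟩ => by simp [h4, h5.not_gt], ?_⟩
    split_ifs with h4 h5 h5
    · simp
    · exfalso
      nlinarith
    · refine Or.inr ⟨by simp, ?_, h5.le, not_lt.1 h4⟩
      by_contra hneg
      push Not at h4 hneg
      nlinarith [mul_pos h5 hQ', mul_nonneg h4 hS'.le, mul_nonneg (neg_nonneg.2 hneg.le) hP']
    · simp
  · intro P Q S hP hQ hS h
    have h1 := signedArea_sum P Q S X
    have h2 := signedArea_barycentric P Q S X
    have hQ' : 0 ≤ X.1 - Q.1 := by linarith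
    have hS' : 0 ≤ X.1 - S.1 := by linarith
    have hP' : 0 < P.1 - X.1 := by linarith
    simp only [triIndicator, edgeCrossing_of_le_of_lt hS hP, edgeCrossing_of_le_of_le hQ hS,
      edgeCrossing_of_lt_of_le hP hQ]
    refine ⟨fun ⟨h3, h4, h5⟩ => by simp [h5, h4.not_gt], ?_⟩
    split_ifs with h4 h5 h5
    · simp
    · refine Or.inr ⟨by simp, ?_, not_lt.1 h5, h4.le⟩
      by_contra hneg
      push Not at h5 hneg
      nlinarith [mul_nonneg h5 hQ', mul_nonneg h4.le hS', mul_pos (neg_pos.2 hneg) hP']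
    · exfalso
      push Not at h4
      nlinarith [mul_nonneg (neg_nonneg.2 h5.le) hQ', mul_nonneg (neg_nonneg.2 h4) hS']
    · simp

theorem isClosed_closedTriangle (P Q S : ℝ × ℝ) : IsClosed (closedTriangle P Q S) := by
  unfold closedTriangle signedArea
  simp only [Set.ofPred_and]
  exact (isClosed_le (by fun_prop) (by fun_prop)).inter
    ((isClosed_le (by fun_prop) (by fun_prop)).inter (isClosed_le (by fun_prop) (by fun_prop)))

theorem signedArea_lineMap (P Q X Y : ℝ × ℝ) (s : ℝ) :
    signedArea P Q (X + s • (Y - X)) = (1 - s) * signedArea P Q X + s * signedArea P Q Y := by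
  simp only [signedArea, Prod.fst_add, Prod.snd_add, Prod.smul_fst, Prod.smul_snd, Prod.fst_sub,
    Prod.snd_sub, smul_eq_mul]
  ring

theorem closedTriangle_subset_closure {P Q S : ℝ × ℝ} (h : 0 < signedArea P Q S) :
    closedTriangle P Q S ⊆ closure (openTriangle P Q S) := by
  intro X ⟨h1, h2, h3⟩
  -- The segment from a point of the closed triangle towards the centroid `G` enters the open
  -- triangle at once.
  set G : ℝ × ℝ := (1 / 3 : ℝ) • (P + Q + S) with hG
  have hG1 : signedArea Q S G = signedArea P Q S / 3 := by
    simp only [hG, signedArea, Prod.fst_add, Prod.snd_add, Prod.smul_fst, Prod.smul_snd,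
      smul_eq_mul]; ring
  have hG2 : signedArea S P G = signedArea P Q S / 3 := by
    simp only [hG, signedArea, Prod.fst_add, Prod.snd_add, Prod.smul_fst, Prod.smul_snd,
      smul_eq_mul]; ring
  have hG3 : signedArea P Q G = signedArea P Q S / 3 := by
    simp only [hG, signedArea, Prod.fst_add, Prod.snd_add, Prod.smul_fst, Prod.smul_snd,
      smul_eq_mul]; ring
  have hlim : Filter.Tendsto (fun s : ℝ => X + s • (G - X)) (nhdsWithin 0 (Set.Ioi 0)) (nhds X) := by
    have : Filter.Tendsto (fun s : ℝ => X + s • (G - X)) (nhds 0) (nhds (X + (0 : ℝ) • (G - X))) :=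
      (Continuous.tendsto (by fun_prop) 0)
    simpa using! this.mono_left nhdsWithin_le_nhds
  refine mem_closure_of_tendsto hlim ?_
  filter_upwards [Ioo_mem_nhdsGT (zero_lt_one' ℝ)] with s hs
  have hs1 : 0 < 1 - s := by linarith [hs.2]
  have hs0 := hs.1
  refine ⟨?_, ?_, ?_⟩ <;> rw [signedArea_lineMap] <;> simp only [hG1, hG2, hG3] <;> positivity

theorem openTriangle_subset_closedTriangle (P Q S : ℝ × ℝ) :
    openTriangle P Q S ⊆ closedTriangle P Q S := fun _ h => ⟨h.1.le, h.2.1.le, h.2.2.le⟩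

/-- An identity between indicator functions of positively oriented triangles is a tiling. -/
theorem tiling_of_sum_triIndicator {ι : Type*} [Fintype ι] {P Q S : ℝ × ℝ}
    (h : 0 < signedArea P Q S) {V : ι → Fin 3 → ℝ × ℝ}
    (hV : ∀ i, 0 < signedArea (V i 0) (V i 1) (V i 2))
    (hsum : ∑ i, triIndicator (V i 0) (V i 1) (V i 2) = triIndicator P Q S) :
    (⋃ i, closedTriangle (V i 0) (V i 1) (V i 2)) = closedTriangle P Q S ∧
    ∀ i j, i ≠ j →
      Disjoint (openTriangle (V i 0) (V i 1) (V i 2)) (openTriangle (V j 0) (V j 1) (V j 2)) := by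
  have hsum' : ∀ X, ∑ i, triIndicator (V i 0) (V i 1) (V i 2) X = triIndicator P Q S X := by
    intro X; rw [← hsum, Finset.sum_apply]
  have hnn : ∀ i X, 0 ≤ triIndicator (V i 0) (V i 1) (V i 2) X := by
    intro i X
    rcases (triIndicator_spec (hV i) X).2 with h | h <;> omega
  refine ⟨Set.Subset.antisymm (Set.iUnion_subset fun i => ?_) ?_, ?_⟩
  -- On an open tile the sum, hence the indicator of the target, is at least 1; taking closures puts
  -- the closed tile inside the target. The reverse inclusion uses that a finite union of closed
  -- tiles is closed, and disjointness that the sum never reaches 2.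
  · refine (closedTriangle_subset_closure (hV i)).trans
      (closure_minimal ?_ (isClosed_closedTriangle P Q S))
    intro X hX
    have h1 := (triIndicator_spec (hV i) X).1 hX
    have h2 : triIndicator (V i 0) (V i 1) (V i 2) X ≤ triIndicator P Q S X := by
      rw [← hsum' X]
      exact Finset.single_le_sum (f := fun i => triIndicator (V i 0) (V i 1) (V i 2) X)
        (fun j _ => hnn j X) (Finset.mem_univ i)
    rcases (triIndicator_spec h X).2 with h3 | h3
    · omega
    · exact h3.2
  · refine (closedTriangle_subset_closure h).trans
      (closure_minimal ?_ (isClosed_iUnion_of_finite fun i => isClosed_closedTriangle _ _ _))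
    intro X hX
    have h1 := (triIndicator_spec h X).1 hX
    rw [← hsum' X] at h1
    obtain ⟨i, -, hi⟩ := Finset.exists_ne_zero_of_sum_ne_zero (h1.trans_ne one_ne_zero)
    exact Set.mem_iUnion.2 ⟨i, ((triIndicator_spec (hV i) X).2.resolve_left hi).2⟩
  · intro i j hij
    rw [Set.disjoint_left]
    intro X hi hj
    have h1 := (triIndicator_spec (hV i) X).1 hi
    have h2 := (triIndicator_spec (hV j) X).1 hj
    have h3 := Finset.add_le_sum (f := fun i => triIndicator (V i 0) (V i 1) (V i 2) X)
      (fun j _ => hnn j X) (Finset.mem_univ i) (Finset.mem_univ j) hij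
    rw [hsum' X] at h3
    simp only [h1, h2] at h3
    rcases (triIndicator_spec h X).2 with h4 | h4 <;> omega

/-! ### Dissections in Eisenstein coordinates. -/

/-- The squared length of `u + v ζ`, where `ζ` is a primitive sixth root of unity. -/
def eisNorm (v : ℝ × ℝ) : ℝ := v.1 ^ 2 + v.1 * v.2 + v.2 ^ 2

/-- The indicator function of the quadrilateral `P Q R S`. -/
noncomputable def quadIndicator (P Q R S : ℝ × ℝ) : ℝ × ℝ → ℤ :=
  fun X => edgeCrossing P Q X + edgeCrossing Q R X + edgeCrossing R S X + edgeCrossing S P X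

/-- The sides of the triangle `P Q S` opposite to its vertices are `a`, `b`, `c`. -/
def IsTile (a b c : ℝ) (P Q S : ℝ × ℝ) : Prop :=
  eisNorm (Q - S) = a ^ 2 ∧ eisNorm (S - P) = b ^ 2 ∧ eisNorm (P - Q) = c ^ 2

/-- The indicator functions of the tiles with sides `a`, `b`, `c`. -/
def tileIndicators (a b c : ℝ) : Set (ℝ × ℝ → ℤ) :=
  {f | ∃ P Q S, 0 < signedArea P Q S ∧ (IsTile a b c Q S P ∨ IsTile a b c S Q P) ∧
    f = triIndicator P Q S}

/-- Sums of indicator functions of tiles. -/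
def IsTileable (a b c : ℝ) (f : ℝ × ℝ → ℤ) : Prop :=
  f ∈ AddSubmonoid.closure (tileIndicators a b c)

/-- Together with `edgeCrossing_swap` this reduces every dissection below to linear arithmetic:
interior edges cancel and subdivided edges add up. -/
theorem edgeCrossing_add {P Q S : ℝ × ℝ} (h : signedArea P Q S = 0) (X : ℝ × ℝ) :
    edgeCrossing P Q X + edgeCrossing Q S X = edgeCrossing P S X := by
  have := congrFun (triIndicator_of_collinear h) X
  simp only [triIndicator, Pi.zero_apply] at this
  rw [edgeCrossing_swap P S] at this
  linarith

theorem triIndicator_eq_corners {X A B C E G : ℝ × ℝ} (hC : signedArea X C A = 0)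
    (hE : signedArea A E B = 0) (hG : signedArea X G B = 0) :
    triIndicator X A B = quadIndicator X C E G + triIndicator C A E + triIndicator G E B := by
  funext Y
  have h1 := edgeCrossing_add hC Y
  have h2 := edgeCrossing_add hE Y
  have h3 := edgeCrossing_add hG Y
  have h4 := edgeCrossing_swap C E Y
  have h5 := edgeCrossing_swap E G Y
  have h6 := edgeCrossing_swap X G Y
  have h7 := edgeCrossing_swap G B Y
  have h8 := edgeCrossing_swap X B Y
  simp only [triIndicator, quadIndicator, Pi.add_apply]
  linarith

theorem quadIndicator_eq_add {P Q R S M L : ℝ × ℝ} (hM : signedArea P M Q = 0)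
    (hL : signedArea R L S = 0) :
    quadIndicator P Q R S = quadIndicator P M L S + quadIndicator M Q R L := by
  funext Y
  have h1 := edgeCrossing_add hM Y
  have h2 := edgeCrossing_add hL Y
  have h3 := edgeCrossing_swap M L Y
  simp only [quadIndicator, Pi.add_apply]
  linarith

theorem quadIndicator_rotate (P Q R S : ℝ × ℝ) : quadIndicator Q R S P = quadIndicator P Q R S := by
  funext Y
  simp only [quadIndicator]
  ring

theorem quadIndicator_diagonal (P Q R S : ℝ × ℝ) :
    quadIndicator P Q R S = triIndicator P Q S + triIndicator R S Q := by
  funext Y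
  have h1 := edgeCrossing_swap S Q Y
  simp only [quadIndicator, triIndicator, Pi.add_apply]
  linarith

theorem eisNorm_neg (v : ℝ × ℝ) : eisNorm (-v) = eisNorm v := by
  simp [eisNorm]

theorem eisNorm_smul (s : ℝ) (v : ℝ × ℝ) : eisNorm (s • v) = s ^ 2 * eisNorm v := by
  simp [eisNorm]; ring

/-- `v` and `w` span a tile at its vertex opposite to the side `c`. -/
def SpansTile (a b c : ℝ) (v w : ℝ × ℝ) : Prop :=
  0 < v.1 * w.2 - v.2 * w.1 ∧ eisNorm (v - w) = c ^ 2 ∧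
    (eisNorm v = a ^ 2 ∧ eisNorm w = b ^ 2 ∨ eisNorm v = b ^ 2 ∧ eisNorm w = a ^ 2)

section
variable {a b c : ℝ}

theorem IsTileable.add {f g : ℝ × ℝ → ℤ} (hf : IsTileable a b c f) (hg : IsTileable a b c g) :
    IsTileable a b c (f + g) := add_mem hf hg

theorem isTileable_zero : IsTileable a b c 0 := zero_mem _

theorem SpansTile.neg {v w : ℝ × ℝ} (h : SpansTile a b c v w) : SpansTile a b c (-v) (-w) := by
  refine ⟨by simpa using h.1, ?_, ?_⟩
  · rw [← h.2.1, ← eisNorm_neg (v - w)]; congr 1; abel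
  · simpa only [eisNorm_neg] using h.2.2

theorem SpansTile.isTileable {v w : ℝ × ℝ} (h : SpansTile a b c v w) (X : ℝ × ℝ) :
    IsTileable a b c (triIndicator X (X + v) (X + w)) := by
  refine AddSubmonoid.subset_closure ⟨X, X + v, X + w, ?_, ?_, rfl⟩
  · have := h.1
    simp only [signedArea, Prod.fst_add, Prod.snd_add]
    linarith
  · obtain ⟨-, h2, ⟨h3, h4⟩ | ⟨h3, h4⟩⟩ := h
    · refine Or.inr ⟨by simpa using h3, ?_, ?_⟩
      · rw [← h4, ← eisNorm_neg w]; congr 1; abel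
      · rw [← h2, ← eisNorm_neg (v - w)]; congr 1; abel
    · refine Or.inl ⟨by simpa using h4, ?_, ?_⟩
      · rw [← h3, ← eisNorm_neg v]; congr 1; abel
      · rw [← h2]; congr 1; abel

theorem SpansTile.isTileable_strip {v w : ℝ × ℝ} (h : SpansTile a b c v w) (m : ℕ) (X : ℝ × ℝ) :
    IsTileable a b c (quadIndicator X (X + (m : ℝ) • v) (X + (m : ℝ) • v + w) (X + w)) := by
  induction m with
  | zero =>
    rw [quadIndicator_diagonal, triIndicator_of_collinear, triIndicator_of_collinear]
    · exact isTileable_zero.add isTileable_zero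
    · simp [signedArea]
    · simp [signedArea]
  | succ m ih =>
    rw [quadIndicator_eq_add (M := X + (m : ℝ) • v) (L := X + (m : ℝ) • v + w)]
    · refine ih.add ?_
      rw [quadIndicator_diagonal]
      refine IsTileable.add ?_ ?_
      · convert! h.isTileable (X + (m : ℝ) • v) using 2
        push_cast; module
      · convert! h.neg.isTileable (X + ((m + 1 : ℕ) : ℝ) • v + w) using 2
        · push_cast; module
        · push_cast; module
    · simp [signedArea]; ring
    · simp [signedArea]; ring

theorem SpansTile.isTileable_parallelogram {v w : ℝ × ℝ} (h : SpansTile a b c v w) (m n : ℕ)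
    (X : ℝ × ℝ) :
    IsTileable a b c (quadIndicator X (X + (m : ℝ) • v) (X + (m : ℝ) • v + (n : ℝ) • w)
      (X + (n : ℝ) • w)) := by
  induction n with
  | zero =>
    rw [quadIndicator_diagonal, triIndicator_of_collinear, triIndicator_of_collinear]
    · exact isTileable_zero.add isTileable_zero
    · simp [signedArea]
    · simp [signedArea]
  | succ n ih =>
    rw [← quadIndicator_rotate, quadIndicator_eq_add (M := X + (m : ℝ) • v + (n : ℝ) • w)
      (L := X + (n : ℝ) • w)]
    · refine IsTileable.add ?_ ?_
      · rw [quadIndicator_rotate]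
        exact ih
      · rw [quadIndicator_rotate]
        convert! h.isTileable_strip m (X + (n : ℝ) • w) using 2 <;> push_cast <;> module
    · simp [signedArea]; ring
    · simp [signedArea]; ring

theorem SpansTile.isTileable_triangle {v w : ℝ × ℝ} (h : SpansTile a b c v w) (k : ℕ) (X : ℝ × ℝ) :
    IsTileable a b c (triIndicator X (X + (k : ℝ) • v) (X + (k : ℝ) • w)) := by
  induction k generalizing X with
  | zero =>
    rw [triIndicator_of_collinear (by simp [signedArea])]
    exact isTileable_zero
  | succ k ih =>
    rw [triIndicator_eq_corners (C := X + (k : ℝ) • v) (E := X + (k : ℝ) • v + w) (G := X + w)]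
    · refine ((h.isTileable_strip k X).add ?_).add ?_
      · convert! h.isTileable (X + (k : ℝ) • v) using 2
        push_cast; module
      · convert! ih (X + w) using 2
        · module
        · push_cast; module
    · simp [signedArea]; ring
    · simp [signedArea]; ring
    · simp [signedArea]; ring

theorem isTileable_triIndicator {P Q S : ℝ × ℝ} {k : ℕ} (hk : 0 < k) (hpos : 0 < signedArea S P Q)
    (hc : eisNorm (P - Q) = (k * c) ^ 2)
    (hab : eisNorm (P - S) = (k * a) ^ 2 ∧ eisNorm (Q - S) = (k * b) ^ 2 ∨
      eisNorm (P - S) = (k * b) ^ 2 ∧ eisNorm (Q - S) = (k * a) ^ 2) :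
    IsTileable a b c (triIndicator S P Q) := by
  have hk' : (k : ℝ) ≠ 0 := by positivity
  have hk0 : (0 : ℝ) < k := by positivity
  have h : SpansTile a b c ((k : ℝ)⁻¹ • (P - S)) ((k : ℝ)⁻¹ • (Q - S)) := by
    refine ⟨?_, ?_, ?_⟩
    · have : ((k : ℝ)⁻¹) ^ 2 * signedArea S P Q > 0 := by positivity
      simp only [signedArea] at this
      simp only [Prod.smul_fst, Prod.smul_snd, Prod.fst_sub, Prod.snd_sub, smul_eq_mul]
      linarith
    · rw [← smul_sub, eisNorm_smul, sub_sub_sub_cancel_right, hc]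
      field_simp
    · simp only [eisNorm_smul]
      refine hab.imp (fun h => ?_) (fun h => ?_) <;> rw [h.1, h.2] <;> constructor <;> field_simp
  convert! h.isTileable_triangle k S using 2
  · rw [smul_inv_smul₀ hk']; abel
  · rw [smul_inv_smul₀ hk']; abel

theorem isTileable_quadIndicator (hc : c ^ 2 = a ^ 2 + a * b + b ^ 2) {P Q R S : ℝ × ℝ} {m n : ℕ}
    (hm : 0 < m) (hn : 0 < n) (hpos : 0 < signedArea P Q S) (hR : R = Q + S - P)
    (ha : eisNorm (Q - P) = (m * a) ^ 2) (hb : eisNorm (S - P) = (n * b) ^ 2)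
    (hQS : eisNorm (Q - S) = (m * a) ^ 2 + (m * a) * (n * b) + (n * b) ^ 2) :
    IsTileable a b c (quadIndicator P Q R S) := by
  have hm' : (m : ℝ) ≠ 0 := by positivity
  have hn' : (n : ℝ) ≠ 0 := by positivity
  have hm0 : (0 : ℝ) < m := by positivity
  have hn0 : (0 : ℝ) < n := by positivity
  have h : SpansTile a b c ((m : ℝ)⁻¹ • (Q - P)) ((n : ℝ)⁻¹ • (S - P)) := by
    refine ⟨?_, ?_, Or.inl ⟨?_, ?_⟩⟩
    · have : ((m : ℝ)⁻¹) * (n : ℝ)⁻¹ * signedArea P Q S > 0 := by positivity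
      simp only [signedArea] at this
      simp only [Prod.smul_fst, Prod.smul_snd, Prod.fst_sub, Prod.snd_sub, smul_eq_mul]
      linarith
    · have e1 : eisNorm ((m : ℝ)⁻¹ • (Q - P) - (n : ℝ)⁻¹ • (S - P)) =
          (m : ℝ)⁻¹ ^ 2 * eisNorm (Q - P) + (n : ℝ)⁻¹ ^ 2 * eisNorm (S - P)
          + (m : ℝ)⁻¹ * (n : ℝ)⁻¹ * (eisNorm (Q - S) - eisNorm (Q - P) - eisNorm (S - P)) := by
        simp only [eisNorm, Prod.smul_fst, Prod.smul_snd, Prod.fst_sub, Prod.snd_sub, smul_eq_mul]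
        ring
      rw [e1, ha, hb, hQS, hc]
      field_simp
      ring
    · rw [eisNorm_smul, ha]; field_simp
    · rw [eisNorm_smul, hb]; field_simp
  convert! h.isTileable_parallelogram m n P using 2 <;> simp only [smul_inv_smul₀ hm',
    smul_inv_smul₀ hn', hR] <;> abel

end

/-- An affine map of the coordinate plane preserving the orientation, the area and the Eisenstein norm. -/
def IsEisFrame (F : ℝ × ℝ → ℝ × ℝ) : Prop :=
  (∀ P Q S, signedArea (F P) (F Q) (F S) = signedArea P Q S) ∧
    (∀ P Q, eisNorm (F P - F Q) = eisNorm (P - Q)) ∧ ∀ P Q S, F (Q + S - P) = F Q + F S - F P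

theorem IsEisFrame.shift {F : ℝ × ℝ → ℝ × ℝ} (hF : IsEisFrame F) (s : ℝ) :
    IsEisFrame fun p => F (p.1, p.2 + s) := by
  refine ⟨fun P Q S => ?_, fun P Q => ?_, fun P Q S => ?_⟩
  · rw [hF.1]; simp only [signedArea]; ring
  · rw [hF.2.1]; simp [eisNorm]
  · refine Eq.trans (congrArg F ?_) (hF.2.2 _ _ _)
    ext
    · simp
    · simp; ring

theorem isEisFrame_id : IsEisFrame id := ⟨fun _ _ _ => rfl, fun _ _ => rfl, fun _ _ _ => rfl⟩

theorem isEisFrame_rotate (s : ℝ) : IsEisFrame fun p => (s - p.1 - p.2, p.1) := by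
  refine ⟨fun P Q S => ?_, fun P Q => ?_, fun P Q S => ?_⟩
  · simp only [signedArea]; ring
  · simp only [eisNorm, Prod.fst_sub, Prod.snd_sub]; ring
  · ext <;> simp; ring

theorem isEisFrame_rotate' (s : ℝ) : IsEisFrame fun p => (p.2, s - p.1 - p.2) := by
  refine ⟨fun P Q S => ?_, fun P Q => ?_, fun P Q S => ?_⟩
  · simp only [signedArea]; ring
  · simp only [eisNorm, Prod.fst_sub, Prod.snd_sub]; ring
  · ext <;> simp; ring

section
variable {a b c : ℕ}

/-- The point `M` divides the top side into `κb²` and `κa²`. Joining it to the ends of the base cuts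
the isosceles trapezoid into three triangles similar to the tile, with ratios `κb`, `κc` and `κa`.
-/
theorem isTileable_trapezoid (ha : 0 < a) (hb : 0 < b)
    (hcc : 0 < c) (hc : (c : ℝ) ^ 2 = a ^ 2 + a * b + b ^ 2)
    {F : ℝ × ℝ → ℝ × ℝ} (hF : IsEisFrame F) {κ : ℕ} (hκ : 0 < κ) :
    IsTileable a b c (quadIndicator (F (0, 0)) (F (κ * (c : ℝ) ^ 2, 0))
      (F (κ * ((a : ℝ) ^ 2 + b ^ 2), κ * (a * b))) (F (0, κ * (a * b)))) := by
  set B := F (0, 0) with hB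
  set B' := F (κ * (c : ℝ) ^ 2, 0) with hB'
  set T := F (0, κ * (a * b)) with hT
  set T' := F (κ * ((a : ℝ) ^ 2 + b ^ 2), κ * (a * b)) with hT'
  set M := F (κ * (b : ℝ) ^ 2, κ * (a * b)) with hM
  have hsplit : quadIndicator B B' T' T =
      triIndicator T B M + triIndicator M B B' + triIndicator T' M B' := by
    have hcol : signedArea T' M T = 0 := by
      rw [hT', hM, hT, hF.1]; simp [signedArea]
    funext Y
    have h1 := edgeCrossing_add hcol Y
    have h2 := edgeCrossing_swap T B Y
    have h3 := edgeCrossing_swap M B Y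
    have h4 := edgeCrossing_swap M B' Y
    have h5 := edgeCrossing_swap T' B' Y
    have h6 := edgeCrossing_swap M T Y
    simp only [triIndicator, quadIndicator, Pi.add_apply]
    linarith
  rw [hsplit]
  have hpos : (0 : ℝ) < κ ^ 2 * (a * b) := by positivity
  have hb2 : (0 : ℝ) < κ ^ 2 * (a * b) * b ^ 2 := by positivity
  have ha2 : (0 : ℝ) < κ ^ 2 * (a * b) * a ^ 2 := by positivity
  have hc2 : (0 : ℝ) < κ ^ 2 * (a * b) * c ^ 2 := by positivity
  refine IsTileable.add (IsTileable.add ?_ ?_) ?_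
  · refine isTileable_triIndicator (k := κ * b) (by positivity) ?_ ?_ (Or.inl ⟨?_, ?_⟩)
    · rw [hT, hB, hM, hF.1]; simp only [signedArea]; linarith
    · rw [hB, hM, hF.2.1, mul_pow, hc]; simp [eisNorm]; ring
    · rw [hB, hT, hF.2.1]; simp [eisNorm]; ring
    · rw [hM, hT, hF.2.1]; simp [eisNorm]; ring
  · refine isTileable_triIndicator (k := κ * c) (by positivity) ?_ ?_ (Or.inr ⟨?_, ?_⟩)
    · rw [hB', hB, hM, hF.1]; simp only [signedArea]; linarith
    · rw [hB, hB', hF.2.1]; simp [eisNorm]; ring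
    · rw [hB, hM, hF.2.1]; push_cast; rw [mul_pow, mul_pow, hc]; simp [eisNorm]; ring
    · rw [hM, hB', hF.2.1]; push_cast; rw [mul_pow, mul_pow, hc]; simp [eisNorm]; ring
  · refine isTileable_triIndicator (k := κ * a) (by positivity) ?_ ?_ (Or.inl ⟨?_, ?_⟩)
    · rw [hT', hB', hM, hF.1]; simp only [signedArea]; rw [hc]; linarith
    · rw [hM, hB', hF.2.1, mul_pow, hc]; simp [eisNorm]; ring
    · rw [hM, hT', hF.2.1]; simp [eisNorm]; ring
    · rw [hB', hT', hF.2.1, hc]; simp [eisNorm]; ring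

/-- A parallelogram with sides `m·a` and `(κa)·b` is attached along the right leg, of length `κab`.
-/
theorem isTileable_wide_trapezoid (ha : 0 < a) (hb : 0 < b)
    (hcc : 0 < c) (hc : (c : ℝ) ^ 2 = a ^ 2 + a * b + b ^ 2)
    {F : ℝ × ℝ → ℝ × ℝ} (hF : IsEisFrame F) {κ : ℕ} (hκ : 0 < κ) (m : ℕ) :
    IsTileable a b c (quadIndicator (F (0, 0)) (F (κ * (c : ℝ) ^ 2 + m * a, 0))
      (F (κ * ((a : ℝ) ^ 2 + b ^ 2) + m * a, κ * (a * b))) (F (0, κ * (a * b)))) := by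
  rcases Nat.eq_zero_or_pos m with rfl | hm
  · simpa using! isTileable_trapezoid ha hb hcc hc hF hκ
  rw [quadIndicator_eq_add (M := F (κ * (c : ℝ) ^ 2, 0))
    (L := F (κ * ((a : ℝ) ^ 2 + b ^ 2), κ * (a * b)))]
  · refine (isTileable_trapezoid ha hb hcc hc hF hκ).add ?_
    have hpos : (0 : ℝ) < m * a * (κ * (a * b)) := by positivity
    refine isTileable_quadIndicator (m := m) (n := κ * a) hc hm (by positivity) ?_ ?_ ?_ ?_ ?_
    · rw [hF.1]; simp only [signedArea]; linarith
    · rw [← hF.2.2]; congr 1; ext <;> simp [hc]; ring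
    · rw [hF.2.1]; simp [eisNorm]
    · rw [hF.2.1, hc]; simp [eisNorm]; ring
    · rw [hF.2.1, hc]; simp [eisNorm]; ring
  · rw [hF.1]; simp [signedArea]
  · rw [hF.1]; simp [signedArea]

/-- Each row is `κab` longer at the bottom than at the top. This is `κb` times `a`, so a wide
trapezoid with `m + nκb` in place of `m` fits under the `n` rows above it. -/
theorem isTileable_stack (ha : 0 < a) (hb : 0 < b)
    (hcc : 0 < c) (hc : (c : ℝ) ^ 2 = a ^ 2 + a * b + b ^ 2) {κ : ℕ} (hκ : 0 < κ) (n : ℕ) :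
    ∀ {F : ℝ × ℝ → ℝ × ℝ}, IsEisFrame F → ∀ m : ℕ,
    IsTileable a b c (quadIndicator (F (0, 0))
      (F (κ * ((a : ℝ) ^ 2 + b ^ 2) + m * a + n * (κ * (a * b)), 0))
      (F (κ * ((a : ℝ) ^ 2 + b ^ 2) + m * a, n * (κ * (a * b)))) (F (0, n * (κ * (a * b))))) := by
  induction n with
  | zero =>
    intro F hF m
    rw [quadIndicator_diagonal, triIndicator_of_collinear, triIndicator_of_collinear]
    · exact isTileable_zero.add isTileable_zero
    · rw [hF.1]; simp [signedArea]
    · rw [hF.1]; simp [signedArea]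
  | succ n ih =>
    intro F hF m
    rw [← quadIndicator_rotate, quadIndicator_eq_add (L := F (0, κ * (a * b)))
      (M := F (κ * ((a : ℝ) ^ 2 + b ^ 2) + m * a + n * (κ * (a * b)), κ * (a * b)))]
    · refine IsTileable.add ?_ ?_
      · rw [quadIndicator_rotate]
        convert! isTileable_wide_trapezoid ha hb hcc hc hF hκ (m + n * (κ * b)) using 3
        · push_cast; rw [hc]; congr 1; ring
        · push_cast; congr 1; ring
      · rw [quadIndicator_rotate]
        convert! ih (hF.shift (κ * (a * b))) m using 3
        · simp
        · simp
        · push_cast; congr 1; ring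
        · push_cast; congr 1; ring
    · rw [hF.1]; simp [signedArea]; ring
    · rw [hF.1]; simp [signedArea]

/-- Three congruent trapezoids with base `2L` and other sides `L` form a pinwheel around the centre
`(L, L)`. Each is a stack with `κ = a` and `2(a² + b²)` rows. -/
theorem isTileable_equilateral (ha : 0 < a) (hb : 0 < b)
    (hcc : 0 < c) (hc : (c : ℝ) ^ 2 = a ^ 2 + a * b + b ^ 2) {L : ℝ}
    (hL : L = 2 * (a ^ 2 + b ^ 2) * a ^ 2 * b) :
    IsTileable a b c (triIndicator (0, 0) (3 * L, 0) (0, 3 * L)) := by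
  have half : ∀ {F : ℝ × ℝ → ℝ × ℝ}, IsEisFrame F →
      IsTileable a b c (quadIndicator (F (0, 0)) (F (2 * L, 0)) (F (L, L)) (F (0, L))) := by
    intro F hF
    -- This `m` makes the top side `a(a² + b²) + ma` equal to `L`; it is a natural number because
    -- `ab ≥ 1`.
    obtain ⟨m, hm⟩ : ∃ m : ℕ, m + (a ^ 2 + b ^ 2) = 2 * (a ^ 2 + b ^ 2) * (a * b) :=
      (Nat.exists_eq_add_of_le' (by
        have := Nat.mul_le_mul_left (a ^ 2 + b ^ 2) (Nat.mul_pos ha hb)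
        nlinarith)).imp fun m h => h.symm
    have hm' : (m : ℝ) = 2 * (a ^ 2 + b ^ 2) * (a * b) - (a ^ 2 + b ^ 2) := by
      have : (m : ℝ) + (a ^ 2 + b ^ 2) = 2 * (a ^ 2 + b ^ 2) * (a * b) := by exact_mod_cast hm
      linarith
    convert! isTileable_stack ha hb hcc hc ha (2 * (a ^ 2 + b ^ 2)) hF m using 3
    · push_cast; rw [hL, hm']; congr 1; ring
    · push_cast; rw [hL, hm']; congr 1 <;> ring
    · push_cast; rw [hL]; congr 1; ring
  have h1 := half isEisFrame_id
  have h2 := half (isEisFrame_rotate (3 * L))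
  have h3 := half (isEisFrame_rotate' (3 * L))
  convert (h1.add h2).add h3 using 1
  simp only [id_eq, sub_zero, show 3 * L - 2 * L = L by ring, show 3 * L - L = 2 * L by ring,
    show 2 * L - L = L by ring]
  funext Y
  have e1 := edgeCrossing_add (P := (0, 0)) (Q := (2 * L, 0)) (S := (3 * L, 0))
    (by simp [signedArea]) Y
  have e2 := edgeCrossing_add (P := (3 * L, 0)) (Q := (L, 2 * L)) (S := (0, 3 * L))
    (by simp [signedArea]; ring) Y
  have e3 := edgeCrossing_add (P := (0, 3 * L)) (Q := (0, L)) (S := (0, 0))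
    (by simp [signedArea]) Y
  have e4 := edgeCrossing_swap (L, L) (2 * L, 0) Y
  have e5 := edgeCrossing_swap (L, L) (L, 2 * L) Y
  have e6 := edgeCrossing_swap (L, L) (0, L) Y
  simp only [triIndicator, quadIndicator, Pi.add_apply]
  linarith

/-- A triangle with angles `α`, `2α`, `3β` splits into four triangles similar to the tile and an
equilateral triangle. -/
theorem isTileable_target (ha : 0 < a) (hb : 0 < b)
    (hcc : 0 < c) (hc : (c : ℝ) ^ 2 = a ^ 2 + a * b + b ^ 2) {M : ℕ}
    (hM : M = 3 * (a ^ 2 + b ^ 2) * a) :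
    IsTileable a b c (triIndicator (-(M * ((2 * b + a) * b) : ℝ),
        0) (M * ((b : ℝ) ^ 2 + 2 * a * b), 0)
      (0, M * ((a : ℝ) ^ 2 + 2 * a * b))) := by
  have hM0 : 0 < M := by rw [hM]; positivity
  have hMr : (M : ℝ) = 3 * (a ^ 2 + b ^ 2) * a := by rw [hM]; push_cast; ring
  set P : ℝ × ℝ := (-(M * ((2 * b + a) * b) : ℝ), 0) with hP
  set Q : ℝ × ℝ := (M * ((b : ℝ) ^ 2 + 2 * a * b), 0) with hQ
  set S : ℝ × ℝ := (0, M * ((a : ℝ) ^ 2 + 2 * a * b)) with hS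
  set D : ℝ × ℝ := (0, 0) with hD
  set U : ℝ × ℝ := (M * (2 * a * b), 0) with hU
  set W : ℝ × ℝ := (0, M * (2 * a * b)) with hW
  set I : ℝ × ℝ := (M * (a * b), M * (a * b)) with hI
  -- `D U W` is equilateral with side `2Mab`, and `I` is the midpoint of `U W`. The choice of `M`
  -- makes this side the `3L` of `isTileable_equilateral`.
  have hsplit : triIndicator P Q S = triIndicator D U W + triIndicator D S P +
      triIndicator U Q I + triIndicator W I S + triIndicator I Q S := by
    funext Y
    have e1 := edgeCrossing_add (P := P) (Q := D) (S := U) (by simp [signedArea, hP, hD, hU]) Y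
    have e2 := edgeCrossing_add (P := P) (Q := U) (S := Q) (by simp [signedArea, hP, hQ, hU]) Y
    have e3 := edgeCrossing_add (P := U) (Q := I) (S := W)
      (by simp [signedArea, hI, hW, hU]; ring) Y
    have e4 := edgeCrossing_add (P := D) (Q := W) (S := S) (by simp [signedArea, hD, hW, hS]) Y
    have e5 := edgeCrossing_swap P D Y
    have e6 := edgeCrossing_swap I Q Y
    have e7 := edgeCrossing_swap I S Y
    have e8 := edgeCrossing_swap U I Y
    have e9 := edgeCrossing_swap W I Y
    have e10 := edgeCrossing_swap D W Y
    have e11 := edgeCrossing_swap D S Y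
    have e12 := edgeCrossing_swap W S Y
    simp only [triIndicator, Pi.add_apply]
    linarith
  rw [hsplit]
  have haR : (0 : ℝ) < a := by positivity
  have hbR : (0 : ℝ) < b := by positivity
  have hMR : (0 : ℝ) < M := by positivity
  refine ((((?_ : IsTileable _ _ _ _).add ?_).add ?_).add ?_).add ?_
  · convert! isTileable_equilateral ha hb hcc hc rfl using 2
    · rw [hU, hMr]; congr 1; ring
    · rw [hW, hMr]; congr 1; ring
  · refine isTileable_triIndicator (k := M * (2 * b + a)) (by positivity) ?_ ?_ (Or.inl ⟨?_, ?_⟩)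
    · have : (0 : ℝ) < M * ((a : ℝ) ^ 2 + 2 * a * b) * (M * ((2 * b + a) * b)) := by positivity
      simp [signedArea, hD, hS, hP]; linarith
    · push_cast; rw [mul_pow, hc]; simp [eisNorm, hS, hP]; ring
    · simp [eisNorm, hS, hD]; ring
    · simp [eisNorm, hP, hD]; ring
  · refine isTileable_triIndicator (k := M * b) (by positivity) ?_ ?_ (Or.inr ⟨?_, ?_⟩)
    · have : (0 : ℝ) < M * (b : ℝ) ^ 2 * (M * (a * b)) := by positivity
      simp [signedArea, hU, hQ, hI]; linarith
    · push_cast; rw [mul_pow, hc]; simp [eisNorm, hQ, hI]; ring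
    · simp [eisNorm, hQ, hU]; ring
    · simp [eisNorm, hI, hU]; ring
  · refine isTileable_triIndicator (k := M * a) (by positivity) ?_ ?_ (Or.inr ⟨?_, ?_⟩)
    · have : (0 : ℝ) < M * (a : ℝ) ^ 2 * (M * (a * b)) := by positivity
      simp [signedArea, hW, hS, hI]; linarith
    · push_cast; rw [mul_pow, hc]; simp [eisNorm, hS, hI]; ring
    · simp [eisNorm, hI, hW]; ring
    · simp [eisNorm, hS, hW]; ring
  · refine isTileable_triIndicator (k := M * c) (by positivity) ?_ ?_ (Or.inr ⟨?_, ?_⟩)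
    · have : (0 : ℝ) < M ^ 2 * (a * b) * (a ^ 2 + a * b + b ^ 2) := by positivity
      simp [signedArea, hI, hS, hQ]; linarith
    · push_cast
      rw [show ((M : ℝ) * c * c) ^ 2 = M ^ 2 * (c ^ 2) ^ 2 by ring, hc]; simp [eisNorm, hS,
          hQ]; ring
    · push_cast; rw [mul_pow, mul_pow, hc]; simp [eisNorm, hQ, hI]; ring
    · push_cast; rw [mul_pow, mul_pow, hc]; simp [eisNorm, hS, hI]; ring

end

/-! ### Transfer to the Euclidean plane. -/

theorem eq_zero_of_eisNorm_eq_zero {v : ℝ × ℝ} (h : eisNorm v = 0) : v = 0 := by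
  unfold eisNorm at h
  have h1 : v.2 = 0 := by nlinarith [sq_nonneg (2 * v.1 + v.2), sq_nonneg v.2]
  have h2 : v.1 = 0 := by rw [h1] at h; nlinarith
  exact Prod.ext h2 h1

/-- `φ` is a similarity of the plane with ratio `l`, where the coordinate plane is identified with the
Euclidean plane by `(u, v) ↦ u + v ζ`. -/
def IsEisSimilarity (φ : ℝ × ℝ →ᵃ[ℝ] Plane) (l : ℝ) : Prop :=
  0 < l ∧ ∀ p q, dist (φ p) (φ q) ^ 2 = l ^ 2 * eisNorm (p - q)

theorem IsEisSimilarity.injective {φ : ℝ × ℝ →ᵃ[ℝ] Plane} {l : ℝ} (h : IsEisSimilarity φ l) :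
    Function.Injective φ := by
  intro p q hpq
  have h1 := h.2 p q
  rw [hpq, dist_self, zero_pow two_ne_zero] at h1
  have h2 : eisNorm (p - q) = 0 :=
    (mul_eq_zero.1 h1.symm).resolve_left (pow_ne_zero _ h.1.ne')
  exact sub_eq_zero.1 (eq_zero_of_eisNorm_eq_zero h2)

theorem IsEisSimilarity.surjective {φ : ℝ × ℝ →ᵃ[ℝ] Plane} {l : ℝ} (h : IsEisSimilarity φ l) :
    Function.Surjective φ := by
  rw [← AffineMap.linear_surjective_iff]
  refine (LinearMap.injective_iff_surjective_of_finrank_eq_finrank ?_).1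
    ((AffineMap.linear_injective_iff φ).2 h.injective)
  simp

theorem IsEisSimilarity.dist_eq {φ : ℝ × ℝ →ᵃ[ℝ] Plane} {l : ℝ} (h : IsEisSimilarity φ l)
    {p q : ℝ × ℝ} {x : ℝ} (hx : 0 ≤ x) (hpq : eisNorm (p - q) = x ^ 2) :
    dist (φ p) (φ q) = l * x := by
  have h1 := h.2 p q
  rw [hpq, ← mul_pow] at h1
  exact (pow_left_inj₀ dist_nonneg (mul_nonneg h.1.le hx) two_ne_zero).1 h1

theorem affineIndependent_iff_signedArea_ne_zero (V : Fin 3 → ℝ × ℝ) :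
    AffineIndependent ℝ V ↔ signedArea (V 0) (V 1) (V 2) ≠ 0 := by
  rw [affineIndependent_iff_of_fintype]
  constructor
  · intro h h0
    have key : ∀ w : Fin 3 → ℝ, ∑ i, w i = 0 → ∑ i, w i • V i = 0 → ∀ i, w i = 0 := by
      intro w hw hw'
      refine h w hw ?_
      rw [Finset.weightedVSub_eq_linear_combination _ hw, hw']
    simp only [signedArea] at h0
    -- When the area vanishes, the differences of first coordinates, and likewise of second
    -- coordinates, are weights of an affine dependence. If they must all vanish, the points
    -- coincide, which gives a nontrivial dependence.
    have k1 := key ![(V 2).1 - (V 1).1, (V 0).1 - (V 2).1, (V 1).1 - (V 0).1]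
      (by simp [Fin.sum_univ_three]) (by
        simp only [Fin.sum_univ_three]
        ext
        · simp; ring
        · simp; linarith)
    have k2 := key ![(V 2).2 - (V 1).2, (V 0).2 - (V 2).2, (V 1).2 - (V 0).2]
      (by simp [Fin.sum_univ_three]) (by
        simp only [Fin.sum_univ_three]
        ext
        · simp; linarith
        · simp; ring)
    have a1 := k1 1; have a2 := k1 2; have b1 := k2 1; have b2 := k2 2
    simp at a1 a2 b1 b2
    have e1 : V 1 = V 0 := Prod.ext (by linarith) (by linarith)
    have k3 := key ![-1, 1, 0] (by simp [Fin.sum_univ_three]) (by simp [Fin.sum_univ_three, e1]) 0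
    simp at k3
  · intro h w hw hw'
    rw [Finset.weightedVSub_eq_linear_combination _ hw, Fin.sum_univ_three] at hw'
    rw [Fin.sum_univ_three] at hw
    have h1 := congrArg Prod.fst hw'
    have h2 := congrArg Prod.snd hw'
    simp only [Prod.fst_add, Prod.snd_add, Prod.smul_fst, Prod.smul_snd, smul_eq_mul,
      Prod.fst_zero, Prod.snd_zero] at h1 h2
    simp only [signedArea] at h
    have z0 : w 0 = 0 := by
      apply (mul_eq_zero.1 (_ : w 0 * _ = 0)).resolve_right h
      linear_combination ((V 1).1 * (V 2).2 - (V 1).2 * (V 2).1) * hw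
        + ((V 1).2 - (V 2).2) * h1 + ((V 2).1 - (V 1).1) * h2
    have z1 : w 1 = 0 := by
      apply (mul_eq_zero.1 (_ : w 1 * _ = 0)).resolve_right h
      linear_combination ((V 2).1 * (V 0).2 - (V 2).2 * (V 0).1) * hw
        + ((V 2).2 - (V 0).2) * h1 + ((V 0).1 - (V 2).1) * h2
    have z2 : w 2 = 0 := by linarith
    intro i
    fin_cases i <;> assumption

/-- Barycentric coordinates are ratios of signed areas. -/
theorem mem_setInterior_iff (t : Affine.Triangle ℝ (ℝ × ℝ)) (I : Set ℝ) (X : ℝ × ℝ)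
    (h : 0 < signedArea (t.points 0) (t.points 1) (t.points 2)) :
    X ∈ t.setInterior I ↔
      signedArea (t.points 1) (t.points 2) X / signedArea (t.points 0) (t.points 1) (t.points 2) ∈ I ∧
      signedArea (t.points 2) (t.points 0) X / signedArea (t.points 0) (t.points 1) (t.points 2) ∈ I ∧
      signedArea (t.points 0) (t.points 1) X / signedArea (t.points 0) (t.points 1) (t.points 2) ∈ I := by
  set D := signedArea (t.points 0) (t.points 1) (t.points 2) with hD
  have hsum : ∑ i, (![signedArea (t.points 1) (t.points 2) X / D,
      signedArea (t.points 2) (t.points 0) X / D,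
      signedArea (t.points 0) (t.points 1) X / D] : Fin 3 → ℝ) i = 1 := by
    simp only [Fin.sum_univ_three, Matrix.cons_val_zero, Matrix.cons_val_one, Matrix.cons_val]
    rw [← add_div, ← add_div, signedArea_sum, div_self h.ne']
  have hX : Finset.univ.affineCombination ℝ t.points
      (![signedArea (t.points 1) (t.points 2) X / D, signedArea (t.points 2) (t.points 0) X / D,
      signedArea (t.points 0) (t.points 1) X / D] : Fin 3 → ℝ) = X := by
    rw [Finset.affineCombination_eq_linear_combination _ _ _ hsum]
    simp only [Fin.sum_univ_three, Matrix.cons_val_zero, Matrix.cons_val_one, Matrix.cons_val]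
    simp only [signedArea] at hD
    ext
    · simp only [signedArea, Prod.fst_add, Prod.smul_fst, smul_eq_mul]
      field_simp
      rw [hD]; ring
    · simp only [signedArea, Prod.snd_add, Prod.smul_snd, smul_eq_mul]
      field_simp
      rw [hD]; ring
  conv_lhs => rw [← hX]
  rw [Affine.Simplex.affineCombination_mem_setInterior_iff hsum, Fin.forall_fin_succ,
    Fin.forall_fin_succ, Fin.forall_fin_one]
  rfl

theorem closedInterior_eq_closedTriangle {V : Fin 3 → ℝ × ℝ} (hV : AffineIndependent ℝ V)
    (h : 0 < signedArea (V 0) (V 1) (V 2)) :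
    (⟨V, hV⟩ : Affine.Triangle ℝ (ℝ × ℝ)).closedInterior = closedTriangle (V 0) (V 1) (V 2) := by
  ext X
  have h1 := signedArea_sum (V 0) (V 1) (V 2) X
  rw [Affine.Simplex.closedInterior, mem_setInterior_iff ⟨V, hV⟩ _ X h]
  simp only [Set.mem_Icc, le_div_iff₀ h, div_le_iff₀ h, closedTriangle, Set.mem_ofPred_eq, zero_mul,
    one_mul]
  constructor
  · rintro ⟨h2, h3, h4⟩; exact ⟨h2.1, h3.1, h4.1⟩
  · rintro ⟨h2, h3, h4⟩; refine ⟨⟨h2, ?_⟩, ⟨h3, ?_⟩, ⟨h4, ?_⟩⟩ <;> linarith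

theorem interior_eq_openTriangle {V : Fin 3 → ℝ × ℝ} (hV : AffineIndependent ℝ V)
    (h : 0 < signedArea (V 0) (V 1) (V 2)) :
    (⟨V, hV⟩ : Affine.Triangle ℝ (ℝ × ℝ)).interior = openTriangle (V 0) (V 1) (V 2) := by
  ext X
  have h1 := signedArea_sum (V 0) (V 1) (V 2) X
  rw [Affine.Simplex.interior, mem_setInterior_iff ⟨V, hV⟩ _ X h]
  simp only [Set.mem_Ioo, lt_div_iff₀ h, div_lt_iff₀ h, openTriangle, Set.mem_ofPred_eq, zero_mul,
    one_mul]
  constructor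
  · rintro ⟨h2, h3, h4⟩; exact ⟨h2.1, h3.1, h4.1⟩
  · rintro ⟨h2, h3, h4⟩; refine ⟨⟨h2, ?_⟩, ⟨h3, ?_⟩, ⟨h4, ?_⟩⟩ <;> linarith

theorem congruent_of_dist_eq {p q : Fin 3 → Plane} (h0 : dist (p 1) (p 2) = dist (q 1) (q 2))
    (h1 : dist (p 2) (p 0) = dist (q 2) (q 0)) (h2 : dist (p 0) (p 1) = dist (q 0) (q 1)) :
    p ≅ q := by
  refine Congruent.of_dist_eq fun i j => ?_
  fin_cases i <;> fin_cases j <;> simp [h0, h1, h2, dist_comm (p 1) (p 0), dist_comm (p 2) (p 1),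
    dist_comm (p 0) (p 2), dist_comm (q 1) (q 0), dist_comm (q 2) (q 1), dist_comm (q 0) (q 2)]

theorem exists_perm_of_mem_tileIndicators {a b c : ℝ} {f : ℝ × ℝ → ℤ}
    (hf : f ∈ tileIndicators a b c) :
    ∃ V : Fin 3 → ℝ × ℝ, 0 < signedArea (V 0) (V 1) (V 2) ∧
      f = triIndicator (V 0) (V 1) (V 2) ∧
      ∃ e : Equiv.Perm (Fin 3), IsTile a b c (V (e 0)) (V (e 1)) (V (e 2)) := by
  obtain ⟨P, Q, S, hpos, h | h, rfl⟩ := hf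
  · refine ⟨![P, Q, S], hpos, rfl, finRotate 3, ?_⟩
    convert! h
  · refine ⟨![P, Q, S], hpos, rfl, Equiv.swap 0 2, ?_⟩
    convert! h

/-- Membership in the additive closure yields a list of tile indicators, and its length is the
number of tiles. The relabelling by `e i` matches each tile's vertices with those of `R`, whatever
its orientation. -/
theorem tilesInto_of_isTileable {a b c : ℝ} (ha : 0 ≤ a) (hb : 0 ≤ b) (hc : 0 ≤ c)
    {φ : ℝ × ℝ →ᵃ[ℝ] Plane} {l : ℝ} (hφ : IsEisSimilarity φ l) {T R : PlaneTriangle}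
    {V : Fin 3 → ℝ × ℝ} (hV : 0 < signedArea (V 0) (V 1) (V 2)) (hT : T.points = φ ∘ V)
    (hR0 : dist (R.points 1) (R.points 2) = l * a) (hR1 : dist (R.points 2) (R.points 0) = l * b)
    (hR2 : dist (R.points 0) (R.points 1) = l * c)
    (h : IsTileable a b c (triIndicator (V 0) (V 1) (V 2))) :
    ∃ N, PlaneTriangle.TilesInto T R N := by
  obtain ⟨L, hL, hsum⟩ := AddSubmonoid.exists_list_of_mem_closure h
  have hmem : ∀ i : Fin L.length,
      L[i.1] ∈ tileIndicators a b c := fun i => hL _ (List.getElem_mem _)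
  choose W hW hWf e he using fun i => exists_perm_of_mem_tileIndicators (hmem i)
  have hind : ∀ i, AffineIndependent ℝ (W i) := fun i =>
    (affineIndependent_iff_signedArea_ne_zero _).2 (hW i).ne'
  obtain ⟨hU, hdisj⟩ := tiling_of_sum_triIndicator hV hW (by
    rw [← hsum, ← Fin.sum_univ_getElem]
    exact Finset.sum_congr rfl fun i _ => (hWf i).symm)
  refine ⟨L.length, fun i => ((⟨W i, hind i⟩ : Affine.Triangle ℝ (ℝ × ℝ)).map φ
    hφ.injective).reindex (e i).symm, fun i => ?_, ?_, fun i j hij => ?_⟩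
  · obtain ⟨h0, h1, h2⟩ := he i
    have d0 := hφ.dist_eq ha h0
    have d1 := hφ.dist_eq hb h1
    have d2 := hφ.dist_eq hc h2
    exact congruent_of_dist_eq (d0.trans hR0.symm) (d1.trans hR1.symm) (d2.trans hR2.symm)
  · simp only [Affine.Simplex.closedInterior_reindex, Affine.Simplex.closedInterior_map,
      closedInterior_eq_closedTriangle (hind _) (hW _)]
    rw [← Set.image_iUnion, hU]
    have hT' : T = (⟨V, (affineIndependent_iff_signedArea_ne_zero _).2 hV.ne'⟩ :
        Affine.Triangle ℝ (ℝ × ℝ)).map φ hφ.injective := Affine.Simplex.ext fun i => by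
      rw [hT]; rfl
    rw [hT', Affine.Simplex.closedInterior_map, closedInterior_eq_closedTriangle _ hV]
  · simp only [Affine.Simplex.interior_reindex, Affine.Simplex.interior_map,
      interior_eq_openTriangle (hind _) (hW _)]
    exact (Set.disjoint_image_iff hφ.injective).2 (hdisj i j hij)

/-! ### Areas in a tiling. -/

-- An affine map of determinant `signedArea P Q S` carries the unit triangle to this one. The
-- measure of the unit triangle need not be computed: being finite and nonzero, it cancels later.
open MeasureTheory in
theorem volume_closedTriangle {P Q S : ℝ × ℝ} (h : 0 < signedArea P Q S) :
    volume (closedTriangle P Q S) =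
      ENNReal.ofReal (signedArea P Q S) * volume (closedTriangle (0, 0) (1, 0) (0, 1)) := by
  set f : ℝ × ℝ →ₗ[ℝ] ℝ × ℝ := Matrix.toLin (Module.Basis.finTwoProd ℝ) (Module.Basis.finTwoProd ℝ)
    !![Q.1 - P.1, S.1 - P.1; Q.2 - P.2, S.2 - P.2] with hf
  have hdet : LinearMap.det f = signedArea P Q S := by
    rw [hf, LinearMap.det_toLin, Matrix.det_fin_two_of]
    simp only [signedArea]; ring
  have hpre : closedTriangle (0, 0) (1, 0) (0, 1) =
      f ⁻¹' ((fun x => P + x) ⁻¹' closedTriangle P Q S) := by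
    ext X
    have e : P + f X = (P.1 + ((Q.1 - P.1) * X.1 + (S.1 - P.1) * X.2),
        P.2 + ((Q.2 - P.2) * X.1 + (S.2 - P.2) * X.2)) := by
      rw [hf, Matrix.toLin_finTwoProd_apply]; rfl
    have e1 : signedArea Q S (P + f X) = signedArea P Q S * (1 - X.1 - X.2) := by
      rw [e]; simp only [signedArea]; ring
    have e2 : signedArea S P (P + f X) = signedArea P Q S * X.1 := by
      rw [e]; simp only [signedArea]; ring
    have e3 : signedArea P Q (P + f X) = signedArea P Q S * X.2 := by
      rw [e]; simp only [signedArea]; ring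
    simp only [closedTriangle, Set.mem_ofPred_eq, Set.mem_preimage, e1, e2, e3,
      mul_nonneg_iff_of_pos_left h]
    simp only [signedArea]
    constructor
    · rintro ⟨h1, h2, h3⟩; refine ⟨?_, ?_, ?_⟩ <;> linarith
    · rintro ⟨h1, h2, h3⟩; refine ⟨?_, ?_, ?_⟩ <;> linarith
  rw [hpre, Measure.addHaar_preimage_linearMap _ (by rw [hdet]; exact h.ne'), hdet,
    measure_preimage_add, ← mul_assoc, ← ENNReal.ofReal_mul h.le, abs_of_pos (inv_pos.2 h),
    mul_inv_cancel₀ h.ne', ENNReal.ofReal_one, one_mul]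

theorem isOpen_openTriangle (P Q S : ℝ × ℝ) : IsOpen (openTriangle P Q S) := by
  unfold openTriangle signedArea
  simp only [Set.ofPred_and]
  exact (isOpen_lt (by fun_prop) (by fun_prop)).inter
    ((isOpen_lt (by fun_prop) (by fun_prop)).inter (isOpen_lt (by fun_prop) (by fun_prop)))

theorem convex_openTriangle (P Q S : ℝ × ℝ) : Convex ℝ (openTriangle P Q S) := by
  have key : ∀ (P Q X Y : ℝ × ℝ) (s t : ℝ), 0 < signedArea P Q X → 0 < signedArea P Q Y →
      0 ≤ s → 0 ≤ t → s + t = 1 → 0 < signedArea P Q (s • X + t • Y) := by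
    intro P Q X Y s t hX hY hs ht hst
    have e : signedArea P Q (s • X + t • Y) = s * signedArea P Q X + t * signedArea P Q Y := by
      have : s = 1 - t := by linarith
      subst this
      simp only [signedArea, Prod.fst_add, Prod.snd_add, Prod.smul_fst, Prod.smul_snd, smul_eq_mul]
      ring
    rw [e]
    rcases hs.eq_or_lt with h | h
    · have ht1 : t = 1 := by linarith
      rw [← h, ht1]; linarith
    · have := mul_pos h hX
      have := mul_nonneg ht hY.le
      linarith
  intro X hX Y hY s t hs ht hst
  exact ⟨key _ _ _ _ _ _ hX.1 hY.1 hs ht hst, key _ _ _ _ _ _ hX.2.1 hY.2.1 hs ht hst,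
    key _ _ _ _ _ _ hX.2.2 hY.2.2 hs ht hst⟩

open MeasureTheory in
theorem volume_openTriangle {P Q S : ℝ × ℝ} (h : 0 < signedArea P Q S) :
    volume (openTriangle P Q S) = volume (closedTriangle P Q S) := by
  refine le_antisymm (measure_mono (openTriangle_subset_closedTriangle P Q S)) ?_
  refine (measure_mono (closedTriangle_subset_closure h)).trans_eq ?_
  exact measure_closure_of_null_frontier ((convex_openTriangle P Q S).addHaar_frontier volume)

open MeasureTheory in
theorem volume_unitTriangle_ne_zero : volume (closedTriangle (0, 0) (1, 0) (0, 1)) ≠ 0 := by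
  have h : 0 < signedArea (0, 0) (1, 0) (0, 1) := by simp [signedArea]
  rw [← volume_openTriangle h]
  refine (isOpen_openTriangle _ _ _).measure_ne_zero _ ⟨(1 / 3, 1 / 3), ?_⟩
  simp only [openTriangle, signedArea, Set.mem_ofPred_eq]
  norm_num

open MeasureTheory in
theorem volume_unitTriangle_ne_top : volume (closedTriangle (0, 0) (1, 0) (0, 1)) ≠ ⊤ := by
  refine ((measure_mono (t := Set.Icc (0 : ℝ × ℝ) 1) ?_).trans_lt
    isCompact_Icc.measure_lt_top).ne
  rintro X ⟨h1, h2, h3⟩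
  simp only [signedArea] at h1 h2 h3
  refine ⟨⟨?_, ?_⟩, ⟨?_, ?_⟩⟩ <;> simp <;> linarith

-- The open tiles are disjoint and the closed ones cover, and both have the same measure because a
-- convex set has null frontier.
open MeasureTheory in
theorem signedArea_eq_sum_of_tiling {ι : Type*} [Fintype ι] {P Q S : ℝ × ℝ}
    (h : 0 < signedArea P Q S) {V : ι → Fin 3 → ℝ × ℝ}
    (hV : ∀ i, 0 < signedArea (V i 0) (V i 1) (V i 2))
    (hU : (⋃ i, closedTriangle (V i 0) (V i 1) (V i 2)) = closedTriangle P Q S)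
    (hdisj : ∀ i j, i ≠ j →
      Disjoint (openTriangle (V i 0) (V i 1) (V i 2)) (openTriangle (V j 0) (V j 1) (V j 2))) :
    ∑ i, signedArea (V i 0) (V i 1) (V i 2) = signedArea P Q S := by
  set κ := volume (closedTriangle (0, 0) (1, 0) (0, 1)) with hκ
  have hsum : ∑ i, volume (closedTriangle (V i 0) (V i 1) (V i 2)) =
      volume (closedTriangle P Q S) := by
    apply le_antisymm
    · simp only [← volume_openTriangle (hV _)]
      rw [← tsum_fintype (L := .unconditional _), ← measure_iUnion (fun i j hij => hdisj i j hij)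
        (fun i => (isOpen_openTriangle _ _ _).measurableSet), ← hU]
      exact measure_mono (Set.iUnion_mono fun i => openTriangle_subset_closedTriangle _ _ _)
    · rw [← hU]
      exact measure_iUnion_fintype_le _ _
  simp only [volume_closedTriangle (hV _), volume_closedTriangle h] at hsum
  rw [← Finset.sum_mul, ← ENNReal.ofReal_sum_of_nonneg (fun i _ => (hV i).le),
    ENNReal.mul_left_inj volume_unitTriangle_ne_zero volume_unitTriangle_ne_top,
    ENNReal.ofReal_eq_ofReal_iff (Finset.sum_nonneg fun i _ => (hV i).le) h.le] at hsum
  exact hsum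

/-! ### The side of the target as a sum of sides of tiles. -/

/-- The part on the horizontal axis of a triangle in the upper half plane. -/
theorem exists_interval_of_triangle {P Q S : ℝ × ℝ} (h : 0 < signedArea P Q S)
    (hP : 0 ≤ P.2) (hQ : 0 ≤ Q.2) (hS : 0 ≤ S.2) :
    ∃ p q : ℝ, p ≤ q ∧
      (q - p = 0 ∨ (q - p) ^ 2 = eisNorm (P - Q) ∨ (q - p) ^ 2 = eisNorm (Q - S) ∨
        (q - p) ^ 2 = eisNorm (S - P)) ∧
      (∀ x, (x, (0 : ℝ)) ∈ closedTriangle P Q S → x ∈ Set.Icc p q) ∧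
      ∀ x ∈ Set.Ioo p q, ∀ᶠ ε in nhdsWithin (0 : ℝ) (Set.Ioi 0), (x, ε) ∈ openTriangle P Q S := by
  -- With two vertices on the axis the trace is that side. Otherwise, by `point` below, it is at
  -- most one vertex, and a degenerate interval is used.
  have edge : ∀ {P Q S : ℝ × ℝ}, 0 < signedArea P Q S → P.2 = 0 → Q.2 = 0 → 0 ≤ S.2 →
      P.1 ≤ Q.1 ∧ (Q.1 - P.1) ^ 2 = eisNorm (P - Q) ∧
      (∀ x, (x, (0 : ℝ)) ∈ closedTriangle P Q S → x ∈ Set.Icc P.1 Q.1) ∧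
      ∀ x ∈ Set.Ioo P.1 Q.1, ∀ᶠ ε in nhdsWithin (0 : ℝ) (Set.Ioi 0),
        (x, ε) ∈ openTriangle P Q S := by
    intro P Q S h hP hQ hS
    have hD : signedArea P Q S = (Q.1 - P.1) * S.2 := by simp only [signedArea, hP, hQ]; ring
    rw [hD] at h
    have hS' : 0 < S.2 := hS.lt_of_ne fun h0 => by rw [← h0] at h; simp at h
    have hPQ : 0 < Q.1 - P.1 := pos_of_mul_pos_left h hS
    refine ⟨by linarith, ?_, ?_, ?_⟩
    · simp [eisNorm, hP, hQ]; ring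
    · rintro x ⟨h1, h2, -⟩
      have e1 : signedArea Q S (x, 0) = S.2 * (Q.1 - x) := by simp only [signedArea, hQ]; ring
      have e2 : signedArea S P (x, 0) = S.2 * (x - P.1) := by simp only [signedArea, hP]; ring
      rw [e1, mul_nonneg_iff_of_pos_left hS'] at h1
      rw [e2, mul_nonneg_iff_of_pos_left hS'] at h2
      exact ⟨by linarith, by linarith⟩
    · intro x hx
      have c1 : Continuous fun ε : ℝ => signedArea Q S (x, ε) := by unfold signedArea; fun_prop
      have c2 : Continuous fun ε : ℝ => signedArea S P (x, ε) := by unfold signedArea; fun_prop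
      have z1 : 0 < signedArea Q S (x, 0) := by
        have : signedArea Q S (x, 0) = S.2 * (Q.1 - x) := by simp only [signedArea, hQ]; ring
        rw [this]; exact mul_pos hS' (by linarith [hx.2])
      have z2 : 0 < signedArea S P (x, 0) := by
        have : signedArea S P (x, 0) = S.2 * (x - P.1) := by simp only [signedArea, hP]; ring
        rw [this]; exact mul_pos hS' (by linarith [hx.1])
      filter_upwards [self_mem_nhdsWithin,
        nhdsWithin_le_nhds ((c1.tendsto 0).eventually_const_lt z1),
        nhdsWithin_le_nhds ((c2.tendsto 0).eventually_const_lt z2)] with ε h0 h1 h2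
      refine ⟨h1, h2, ?_⟩
      have : signedArea P Q (x, ε) = (Q.1 - P.1) * ε := by simp only [signedArea, hP, hQ]; ring
      rw [this]; exact mul_pos hPQ h0
  have point : ∀ {P Q S : ℝ × ℝ}, 0 < signedArea P Q S → 0 ≤ P.2 → 0 < Q.2 → 0 < S.2 →
      ∀ x, (x, (0 : ℝ)) ∈ closedTriangle P Q S → x ∈ Set.Icc P.1 P.1 := by
    rintro P Q S h hP hQ hS x ⟨h1, h2, h3⟩
    have e1 : signedArea Q S (x, 0) * P.2 + signedArea S P (x, 0) * Q.2
        + signedArea P Q (x, 0) * S.2 = 0 := by simp only [signedArea]; ring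
    have f1 := mul_nonneg h1 hP
    have f2 := mul_nonneg h2 hQ.le
    have f3 := mul_nonneg h3 hS.le
    have g2 : signedArea S P (x, 0) = 0 :=
      (mul_eq_zero.1 (by linarith : signedArea S P (x, 0) * Q.2 = 0)).resolve_right hQ.ne'
    have g3 : signedArea P Q (x, 0) = 0 :=
      (mul_eq_zero.1 (by linarith : signedArea P Q (x, 0) * S.2 = 0)).resolve_right hS.ne'
    have hs := signedArea_sum P Q S (x, 0)
    have hb := signedArea_barycentric P Q S (x, 0)
    rw [g2, g3] at hs hb
    have : P.1 - x = 0 := by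
      refine (mul_eq_zero.1 (by linarith : signedArea Q S (x, 0) * (P.1 - x) = 0)).resolve_left ?_
      linarith
    rw [Set.Icc_self, Set.mem_singleton_iff]
    linarith
  have hQ' : 0 < signedArea Q S P := by rwa [signedArea_rotate P Q S]
  have hS' : 0 < signedArea S P Q := by rwa [signedArea_rotate Q S P]
  have rot : ∀ X, X ∈ closedTriangle P Q S → X ∈ closedTriangle Q S P := fun X hX =>
    ⟨hX.2.1, hX.2.2, hX.1⟩
  have rot' : ∀ X, X ∈ closedTriangle P Q S → X ∈ closedTriangle S P Q := fun X hX =>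
    ⟨hX.2.2, hX.1, hX.2.1⟩
  have hempty : ∀ y x : ℝ, x ∈ Set.Ioo y y →
      ∀ᶠ ε in nhdsWithin (0 : ℝ) (Set.Ioi 0), (x, ε) ∈ openTriangle P Q S := by
    intro y x hx; simp at hx
  rcases hP.eq_or_lt with hP0 | hP0 <;> rcases hQ.eq_or_lt with hQ0 | hQ0 <;>
    rcases hS.eq_or_lt with hS0 | hS0
  · obtain ⟨h1, h2, h3, h4⟩ := edge h hP0.symm hQ0.symm hS
    exact ⟨_, _, h1, Or.inr (Or.inl h2), h3, h4⟩
  · obtain ⟨h1, h2, h3, h4⟩ := edge h hP0.symm hQ0.symm hS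
    exact ⟨_, _, h1, Or.inr (Or.inl h2), h3, h4⟩
  · obtain ⟨h1, h2, h3, h4⟩ := edge hS' hS0.symm hP0.symm hQ
    exact ⟨_, _, h1, Or.inr (Or.inr (Or.inr h2)), fun x hx => h3 x (rot' _ hx), fun x hx =>
      (h4 x hx).mono fun ε hε => ⟨hε.2.1, hε.2.2, hε.1⟩⟩
  · exact ⟨P.1, P.1, le_rfl, Or.inl (sub_self _), point h hP hQ0 hS0, hempty _⟩
  · obtain ⟨h1, h2, h3, h4⟩ := edge hQ' hQ0.symm hS0.symm hP
    exact ⟨_, _, h1, Or.inr (Or.inr (Or.inl h2)), fun x hx => h3 x (rot _ hx), fun x hx =>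
      (h4 x hx).mono fun ε hε => ⟨hε.2.2, hε.1, hε.2.1⟩⟩
  · exact ⟨Q.1, Q.1, le_rfl, Or.inl (sub_self _), fun x hx => point hQ' hQ hS0 hP0 x (rot _ hx),
      hempty _⟩
  · exact ⟨S.1, S.1, le_rfl, Or.inl (sub_self _), fun x hx => point hS' hS hP0 hQ0 x (rot' _ hx),
      hempty _⟩
  · exact ⟨P.1, P.1, le_rfl, Or.inl (sub_self _), point h hP hQ0 hS0, hempty _⟩

theorem vertex_mem_closedTriangle {V : Fin 3 → ℝ × ℝ} (h : 0 < signedArea (V 0) (V 1) (V 2))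
    (j : Fin 3) : V j ∈ closedTriangle (V 0) (V 1) (V 2) := by
  have hr1 := signedArea_rotate (V 0) (V 1) (V 2)
  have hr2 := signedArea_rotate (V 1) (V 2) (V 0)
  have hz : ∀ X Y : ℝ × ℝ, signedArea X Y X = 0 ∧ signedArea X Y Y = 0 := by
    intro X Y; simp only [signedArea]; constructor <;> ring
  fin_cases j <;> refine ⟨?_, ?_, ?_⟩ <;> simp [hz, hr1, hr2, h.le]

-- The traces of the tiles on the base cover it. Their open intervals are disjoint, since just above
-- a common point two open tiles would meet. Comparing lengths gives the sum.
open MeasureTheory in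
theorem side_eq_sum_of_tiling {ι : Type*} [Fintype ι] {P Q S : ℝ × ℝ}
    (h : 0 < signedArea P Q S) (hP : P.2 = 0) (hQ : Q.2 = 0) {V : ι → Fin 3 → ℝ × ℝ}
    (hV : ∀ i, 0 < signedArea (V i 0) (V i 1) (V i 2))
    (hU : (⋃ i, closedTriangle (V i 0) (V i 1) (V i 2)) = closedTriangle P Q S)
    (hdisj : ∀ i j, i ≠ j →
      Disjoint (openTriangle (V i 0) (V i 1) (V i 2)) (openTriangle (V j 0) (V j 1) (V j 2)))
    (hS : 0 < S.2) :
    ∃ f : ι → ℝ, (∀ i, 0 ≤ f i ∧ (f i = 0 ∨ f i ^ 2 = eisNorm (V i 0 - V i 1) ∨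
      f i ^ 2 = eisNorm (V i 1 - V i 2) ∨ f i ^ 2 = eisNorm (V i 2 - V i 0))) ∧
      Q.1 - P.1 = ∑ i, f i := by
  have hD : signedArea P Q S = (Q.1 - P.1) * S.2 := by simp only [signedArea, hP, hQ]; ring
  have hPQ : 0 < Q.1 - P.1 := pos_of_mul_pos_left (hD ▸ h) hS.le
  have hbase : ∀ x, (x, (0 : ℝ)) ∈ closedTriangle P Q S ↔ x ∈ Set.Icc P.1 Q.1 := by
    intro x
    have e1 : signedArea Q S (x, 0) = S.2 * (Q.1 - x) := by simp only [signedArea, hQ]; ring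
    have e2 : signedArea S P (x, 0) = S.2 * (x - P.1) := by simp only [signedArea, hP]; ring
    have e3 : signedArea P Q (x, 0) = 0 := by simp only [signedArea, hP, hQ]; ring
    simp only [closedTriangle, Set.mem_ofPred_eq, e1, e2, e3, mul_nonneg_iff_of_pos_left hS,
      sub_nonneg, le_refl, and_true, Set.mem_Icc]
    exact and_comm
  have hsub : ∀ i, closedTriangle (V i 0) (V i 1) (V i 2) ⊆ closedTriangle P Q S := fun i => by
    rw [← hU]; exact Set.subset_iUnion_of_subset i subset_rfl
  have hnn : ∀ i j, 0 ≤ (V i j).2 := by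
    intro i j
    have h1 := (hsub i (vertex_mem_closedTriangle (hV i) j)).2.2
    have e : signedArea P Q (V i j) = (Q.1 - P.1) * (V i j).2 := by
      simp only [signedArea, hP, hQ]; ring
    rwa [e, mul_nonneg_iff_of_pos_left hPQ] at h1
  choose p q hpq hlen hJ hI using fun i =>
    exists_interval_of_triangle (hV i) (hnn i 0) (hnn i 1) (hnn i 2)
  refine ⟨fun i => q i - p i, fun i => ⟨sub_nonneg.2 (hpq i), hlen i⟩, ?_⟩
  have hsum : ∑ i, ENNReal.ofReal (q i - p i) = ENNReal.ofReal (Q.1 - P.1) := by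
    apply le_antisymm
    · simp only [← Real.volume_Ioo]
      rw [← tsum_fintype (L := .unconditional _), ← measure_iUnion ?_ fun i => measurableSet_Ioo]
      · rw [Real.volume_Ioo, ← Real.volume_Icc]
        refine measure_mono (Set.iUnion_subset fun i x hx => (hbase x).1 ?_)
        refine (isClosed_closedTriangle P Q S).mem_of_frequently_of_tendsto
          (f := fun ε : ℝ => (x, ε)) (b := nhdsWithin (0 : ℝ) (Set.Ioi 0)) ?_ ?_
        · exact ((hI i x hx).mono fun ε hε =>
            hsub i (openTriangle_subset_closedTriangle _ _ _ hε)).frequently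
        · exact (Continuous.tendsto (by fun_prop) (0 : ℝ)).mono_left nhdsWithin_le_nhds
      · intro i j hij
        refine Set.disjoint_left.2 fun x hx hx' => ?_
        obtain ⟨ε, h1, h2⟩ := ((hI i x hx).and (hI j x hx')).exists
        exact Set.disjoint_left.1 (hdisj i j hij) h1 h2
    · simp only [← Real.volume_Icc]
      refine (measure_mono ?_).trans (measure_iUnion_fintype_le _ _)
      intro x hx
      have h1 := (hbase x).2 hx
      rw [← hU] at h1
      obtain ⟨i, hi⟩ := Set.mem_iUnion.1 h1
      exact Set.mem_iUnion.2 ⟨i, hJ i x hi⟩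
  rw [← ENNReal.ofReal_sum_of_nonneg (fun i _ => sub_nonneg.2 (hpq i)),
    ENNReal.ofReal_eq_ofReal_iff (Finset.sum_nonneg fun i _ => sub_nonneg.2 (hpq i)) hPQ.le] at hsum
  exact hsum.symm

/-! ### Coordinates for given triangles, and the rational parametrisation. -/

/-- Three proportional sides determine the affine map, and by polarisation they also determine the
inner product of two edge vectors, so the map scales all lengths. -/
theorem exists_isEisSimilarity {V : Fin 3 → ℝ × ℝ} (hV : signedArea (V 0) (V 1) (V 2) ≠ 0)
    {p : Fin 3 → Plane} {l : ℝ} (hl : 0 < l)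
    (h12 : dist (p 1) (p 2) ^ 2 = l ^ 2 * eisNorm (V 1 - V 2))
    (h20 : dist (p 2) (p 0) ^ 2 = l ^ 2 * eisNorm (V 2 - V 0))
    (h01 : dist (p 0) (p 1) ^ 2 = l ^ 2 * eisNorm (V 0 - V 1)) :
    ∃ φ : ℝ × ℝ →ᵃ[ℝ] Plane, IsEisSimilarity φ l ∧ p = φ ∘ V := by
  set D := signedArea (V 0) (V 1) (V 2) with hD
  set v := V 1 - V 0 with hv
  set w := V 2 - V 0 with hw
  set e := p 1 - p 0 with he
  set f := p 2 - p 0 with hf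
  have hDvw : D = v.1 * w.2 - v.2 * w.1 := by
    rw [hD]; simp only [signedArea, hv, hw, Prod.fst_sub, Prod.snd_sub]
  -- By Cramer's rule, `α` and `β` are the coordinates with respect to the basis `v`, `w`.
  set α : ℝ × ℝ →ₗ[ℝ] ℝ := (w.2 / D) • LinearMap.fst ℝ ℝ ℝ - (w.1 / D) • LinearMap.snd ℝ ℝ ℝ with hα
  set β : ℝ × ℝ →ₗ[ℝ] ℝ := (v.1 / D) • LinearMap.snd ℝ ℝ ℝ - (v.2 / D) • LinearMap.fst ℝ ℝ ℝ with hβ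
  have hαx : ∀ x, α x = (w.2 * x.1 - w.1 * x.2) / D := by
    intro x; simp [hα]; ring
  have hβx : ∀ x, β x = (v.1 * x.2 - v.2 * x.1) / D := by
    intro x; simp [hβ]; ring
  have hx1 : ∀ x, x.1 = α x * v.1 + β x * w.1 := by
    intro x; rw [hαx, hβx]; field_simp; rw [hDvw]; ring
  have hx2 : ∀ x, x.2 = α x * v.2 + β x * w.2 := by
    intro x; rw [hαx, hβx]; field_simp; rw [hDvw]; ring
  set L : ℝ × ℝ →ₗ[ℝ] Plane := α.smulRight e + β.smulRight f with hL
  have hLx : ∀ x, L x = α x • e + β x • f := fun x => by simp [hL]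
  have hee : ‖e‖ ^ 2 = l ^ 2 * eisNorm v := by
    rw [he, ← dist_eq_norm, dist_comm, h01, ← eisNorm_neg, neg_sub]
  have hff : ‖f‖ ^ 2 = l ^ 2 * eisNorm w := by
    rw [hf, ← dist_eq_norm, h20]
  have hef : 2 * inner ℝ e f = l ^ 2 * (eisNorm v + eisNorm w - eisNorm (v - w)) := by
    have h1 := norm_sub_sq_real e f
    have h2 : ‖e - f‖ ^ 2 = l ^ 2 * eisNorm (v - w) := by
      rw [he, hf, sub_sub_sub_cancel_right, ← dist_eq_norm, h12, hv, hw, sub_sub_sub_cancel_right]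
    linarith
  have hnorm : ∀ x, ‖L x‖ ^ 2 = l ^ 2 * eisNorm x := by
    intro x
    rw [hLx, norm_add_sq_real, norm_smul, norm_smul, mul_pow, mul_pow, hee, hff,
      real_inner_smul_left, real_inner_smul_right, Real.norm_eq_abs, Real.norm_eq_abs, sq_abs,
          sq_abs]
    have h2 : eisNorm x = (α x * v.1 + β x * w.1) ^ 2
        + (α x * v.1 + β x * w.1) * (α x * v.2 + β x * w.2) + (α x * v.2 + β x * w.2) ^ 2 := by
      rw [← hx1, ← hx2]; rfl
    rw [h2]
    simp only [eisNorm, Prod.fst_sub, Prod.snd_sub] at hef ⊢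
    linear_combination (α x * β x) * hef
  refine ⟨AffineMap.mk' (fun x => L (x - V 0) + p 0) L (V 0) (fun x => by simp), ⟨hl,
      fun x y => ?_⟩,
    ?_⟩
  · simp only [AffineMap.coe_mk']
    rw [dist_add_right, dist_eq_norm, ← map_sub, sub_sub_sub_cancel_right, hnorm]
  · funext i
    simp only [Function.comp_apply, AffineMap.coe_mk', hLx, hαx, hβx]
    fin_cases i
    · simp
    · have h1 : (w.2 * v.1 - w.1 * v.2) / D = 1 := by
        rw [div_eq_one_iff_eq hV, hDvw]; ring
      have h2 : (v.1 * v.2 - v.2 * v.1) / D = 0 := by rw [mul_comm, sub_self, zero_div]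
      simp [← hv, h1, h2, he]
    · have h1 : (w.2 * w.1 - w.1 * w.2) / D = 0 := by rw [mul_comm, sub_self, zero_div]
      have h2 : (v.1 * w.2 - v.2 * w.1) / D = 1 := by rw [div_eq_one_iff_eq hV, hDvw]
      simp [← hw, h1, h2, hf]

/-- A triangle with angles `x`, `y`, `z` can be relabelled so that its angles are in this order; its
sides are then proportional to the sines. -/
theorem PlaneTriangle.HasAngles.exists_sides {T : PlaneTriangle} {x y z : ℝ}
    (h : PlaneTriangle.HasAngles T x y z) :
    0 < x ∧ 0 < y ∧ 0 < z ∧ x + y + z = Real.pi ∧ ∃ (σ : Equiv.Perm (Fin 3)) (k : ℝ), 0 < k ∧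
      dist (T.points (σ 1)) (T.points (σ 2)) = k * Real.sin x ∧
      dist (T.points (σ 2)) (T.points (σ 0)) = k * Real.sin y ∧
      dist (T.points (σ 0)) (T.points (σ 1)) = k * Real.sin z := by
  obtain ⟨σ, h0, h1, h2⟩ := h
  have hσ : ∀ σ : Equiv.Perm (Fin 3),
      (σ 0 + 1 = σ 1 ∧ σ 0 + 2 = σ 2 ∧ σ 1 + 1 = σ 2 ∧ σ 1 + 2 = σ 0 ∧ σ 2 + 1 = σ 0 ∧ σ 2 + 2 =
          σ 1) ∨
      (σ 0 + 1 = σ 2 ∧ σ 0 + 2 = σ 1 ∧ σ 1 + 1 = σ 0 ∧ σ 1 + 2 = σ 2 ∧ σ 2 + 1 = σ 1 ∧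
        σ 2 + 2 = σ 0) := by decide
  have hang : ∠ (T.points (σ 1)) (T.points (σ 0)) (T.points (σ 2)) = x ∧
      ∠ (T.points (σ 2)) (T.points (σ 1)) (T.points (σ 0)) = y ∧
      ∠ (T.points (σ 0)) (T.points (σ 2)) (T.points (σ 1)) = z := by
    unfold PlaneTriangle.angleAt at h0 h1 h2
    rcases hσ σ with ⟨e1, e2, e3, e4, e5, e6⟩ | ⟨e1, e2, e3, e4, e5, e6⟩
    · rw [e1, e2] at h0; rw [e3, e4] at h1; rw [e5, e6] at h2
      exact ⟨h0, h1, h2⟩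
    · rw [e1, e2, EuclideanGeometry.angle_comm] at h0
      rw [e3, e4, EuclideanGeometry.angle_comm] at h1
      rw [e5, e6, EuclideanGeometry.angle_comm] at h2
      exact ⟨h0, h1, h2⟩
  obtain ⟨a0, a1, a2⟩ := hang
  have hind := (affineIndependent_equiv σ).2 T.independent
  have hne : ∀ i j : Fin 3, i ≠ j → T.points (σ i) ≠ T.points (σ j) := fun i j hij he =>
    hij (hind.injective he)
  have hcol : ¬ Collinear ℝ {T.points (σ 0), T.points (σ 1), T.points (σ 2)} := by
    rw [← affineIndependent_iff_not_collinear_set]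
    convert! hind using 1
    funext i; fin_cases i <;> rfl
  have s0 : 0 < Real.sin x := by
    rw [← a0]
    refine EuclideanGeometry.sin_pos_of_not_collinear fun hc => hcol (by
      rwa [Set.insert_comm] at hc)
  have s1 : 0 < Real.sin y := by
    rw [← a1]
    refine EuclideanGeometry.sin_pos_of_not_collinear fun hc => hcol (by
      rwa [Set.insert_comm, Set.pair_comm, Set.insert_comm] at hc)
  have s2 : 0 < Real.sin z := by
    rw [← a2]
    refine EuclideanGeometry.sin_pos_of_not_collinear fun hc => hcol (by
      rwa [Set.pair_comm] at hc)
  have pos : ∀ {u : ℝ}, 0 ≤ u → 0 < Real.sin u → 0 < u := by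
    intro u hu hs
    refine hu.lt_of_ne ?_
    rintro rfl
    simp at hs
  refine ⟨pos (a0 ▸ EuclideanGeometry.angle_nonneg _ _ _) s0,
    pos (a1 ▸ EuclideanGeometry.angle_nonneg _ _ _) s1,
    pos (a2 ▸ EuclideanGeometry.angle_nonneg _ _ _) s2, ?_, σ,
    dist (T.points (σ 1)) (T.points (σ 2)) / Real.sin x, ?_, ?_, ?_, ?_⟩
  · have := EuclideanGeometry.angle_add_angle_add_angle_eq_pi (T.points (σ 2)) (hne 1 0 (by decide))
    rw [EuclideanGeometry.angle_comm (T.points (σ 1)) (T.points (σ 2)) (T.points (σ 0)), a2] at this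
    rw [EuclideanGeometry.angle_comm (T.points (σ 0)), a1,
      EuclideanGeometry.angle_comm (T.points (σ 2)), a0] at this
    linarith
  · exact div_pos (dist_pos.2 (hne 1 2 (by decide))) s0
  · rw [div_mul_cancel₀ _ s0.ne']
  · have := EuclideanGeometry.law_sin (T.points (σ 0)) (T.points (σ 1)) (T.points (σ 2))
    rw [EuclideanGeometry.angle_comm (T.points (σ 0)), a1,
      EuclideanGeometry.angle_comm (T.points (σ 2)), a0] at this
    field_simp
    linarith
  · have := EuclideanGeometry.law_sin (T.points (σ 1)) (T.points (σ 2)) (T.points (σ 0))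
    have h3 := EuclideanGeometry.law_sin (T.points (σ 0)) (T.points (σ 1)) (T.points (σ 2))
    have h4 := EuclideanGeometry.law_sin (T.points (σ 2)) (T.points (σ 0)) (T.points (σ 1))
    rw [EuclideanGeometry.angle_comm (T.points (σ 2)), a0,
        EuclideanGeometry.angle_comm (T.points (σ 1)),
      a2, dist_comm (T.points (σ 1))] at h4
    rw [dist_comm (T.points (σ 1))]
    field_simp
    linarith

theorem exists_parameters {A : ℝ} (h0 : 0 < A) (h1 : A < Real.pi / 3)
    (hrat : ∃ q : ℚ, √3 * Real.tan (A / 2) = (q : ℝ)) :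
    ∃ p q : ℕ, 0 < p ∧ 3 * p < q ∧ Real.tan (A / 2) = √3 * (p / q) ∧
      Real.sin A = √3 * (4 * p * q) / (2 * (q ^ 2 + 3 * p ^ 2)) ∧
      Real.cos A = (q ^ 2 - 3 * p ^ 2) / (q ^ 2 + 3 * p ^ 2) := by
  obtain ⟨r, hr⟩ := hrat
  have hs3 : (0 : ℝ) < √3 := by positivity
  have hs : √3 * √3 = (3 : ℝ) := Real.mul_self_sqrt (by norm_num)
  have htan0 : 0 < Real.tan (A / 2) :=
    Real.tan_pos_of_pos_of_lt_pi_div_two (by linarith) (by linarith [Real.pi_pos])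
  have htan1 : Real.tan (A / 2) < 1 / √3 := by
    rw [← Real.tan_pi_div_six]
    exact Real.tan_lt_tan_of_lt_of_lt_pi_div_two (by linarith [Real.pi_pos])
      (by linarith [Real.pi_pos]) (by linarith)
  have hr0 : (0 : ℝ) < r := by rw [← hr]; positivity
  have hr1 : (r : ℝ) < 1 := by
    rw [← hr]
    calc √3 * Real.tan (A / 2) < √3 * (1 / √3) := by gcongr
      _ = 1 := by field_simp
  set u : ℚ := r / 3 with hu
  have hu0 : 0 < u := by
    have : (0 : ℚ) < r := by exact_mod_cast hr0
    positivity
  have hu1 : 3 * u < 1 := by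
    have : r < (1 : ℚ) := by exact_mod_cast hr1
    rw [hu]; linarith
  obtain ⟨p, hp⟩ := Int.eq_ofNat_of_zero_le (Rat.num_pos.2 hu0).le
  have hup : (u : ℝ) = p / u.den := by
    have h2 : (u : ℝ) = (u.num : ℝ) / u.den := by exact_mod_cast (Rat.num_div_den u).symm
    rw [h2, hp]; rfl
  have hq0 : (0 : ℝ) < u.den := by exact_mod_cast u.den_pos
  have htan : Real.tan (A / 2) = √3 * (p / u.den) := by
    rw [← hup, hu]; push_cast; rw [← hr]
    linear_combination -(Real.tan (A / 2) / 3) * hs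
  have hcos : 0 < Real.cos (A / 2) :=
    Real.cos_pos_of_mem_Ioo ⟨by linarith [Real.pi_pos], by linarith [Real.pi_pos]⟩
  have hsin : Real.sin (A / 2) = √3 * (p / u.den) * Real.cos (A / 2) := by
    rw [← htan, Real.tan_mul_cos hcos.ne']
  have hsq := Real.sin_sq_add_cos_sq (A / 2)
  have hc2 : Real.cos (A / 2) ^ 2 = u.den ^ 2 / (u.den ^ 2 + 3 * p ^ 2) := by
    rw [hsin] at hsq
    rw [eq_div_iff (by positivity)]
    field_simp at hsq
    linear_combination hsq - p ^ 2 * Real.cos (A / 2) ^ 2 * hs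
  have hA : A = 2 * (A / 2) := by ring
  refine ⟨p, u.den, ?_, ?_, htan, ?_, ?_⟩
  · have : 0 < u.num := Rat.num_pos.2 hu0
    omega
  · have h2 : 3 * (u : ℝ) < 1 := by exact_mod_cast hu1
    rw [hup] at h2
    have : 3 * (p : ℝ) < u.den := by
      rw [mul_div_assoc', div_lt_one hq0] at h2; exact h2
    exact_mod_cast this
  · rw [hA, Real.sin_two_mul, hsin]
    rw [show 2 * (√3 * (p / u.den) * Real.cos (A / 2)) * Real.cos (A / 2) =
      2 * √3 * (p / u.den) * Real.cos (A / 2) ^ 2 by ring, hc2]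
    field_simp
    ring
  · rw [hA, Real.cos_two_mul, hc2]
    field_simp
    ring

/-- A negatively oriented preimage is made positive by exchanging the labels 1 and 2. -/
theorem exists_coordinates {φ : ℝ × ℝ →ᵃ[ℝ] Plane} {l : ℝ} (hφ : IsEisSimilarity φ l)
    (S : PlaneTriangle) :
    ∃ V : Fin 3 → ℝ × ℝ, 0 < signedArea (V 0) (V 1) (V 2) ∧
      S.closedInterior = φ '' closedTriangle (V 0) (V 1) (V 2) ∧
      S.interior = φ '' openTriangle (V 0) (V 1) (V 2) ∧
      ((∀ j, S.points j = φ (V j)) ∨ ∀ j, S.points j = φ (V (Equiv.swap 1 2 j))) := by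
  choose W hW using fun j => hφ.surjective (S.points j)
  have hWi : AffineIndependent ℝ W := by
    refine AffineIndependent.of_comp φ ?_
    rw [show φ ∘ W = S.points from funext hW]
    exact S.independent
  have hne := (affineIndependent_iff_signedArea_ne_zero W).1 hWi
  rcases hne.lt_or_gt with hneg | hpos
  · have hVi := (affineIndependent_equiv (Equiv.swap (1 : Fin 3) 2)).2 hWi
    have hVpos : 0 < signedArea ((W ∘ Equiv.swap (1 : Fin 3) 2) 0) ((W ∘ Equiv.swap (1 : Fin 3) 2) 1)
        ((W ∘ Equiv.swap (1 : Fin 3) 2) 2) := by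
      have : signedArea (W 0) (W 2) (W 1) = -signedArea (W 0) (W 1) (W 2) := by
        simp only [signedArea]; ring
      simp only [Function.comp_apply, Equiv.swap_apply_left, Equiv.swap_apply_right,
        Equiv.swap_apply_of_ne_of_ne (show (0 : Fin 3) ≠ 1 by decide) (show (0 : Fin 3) ≠ 2 by decide)]
      linarith
    have hS : S = ((⟨_, hVi⟩ : Affine.Triangle ℝ (ℝ × ℝ)).map φ hφ.injective).reindex
        (Equiv.swap (1 : Fin 3) 2) := Affine.Simplex.ext fun j => by
      change S.points j = φ (W (Equiv.swap 1 2 ((Equiv.swap (1 : Fin 3) 2).symm j)))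
      rw [Equiv.symm_swap, Equiv.swap_apply_self, hW]
    refine ⟨_, hVpos, ?_, ?_, Or.inr fun j => ?_⟩
    · rw [hS, Affine.Simplex.closedInterior_reindex, Affine.Simplex.closedInterior_map,
        closedInterior_eq_closedTriangle hVi hVpos]
    · rw [hS, Affine.Simplex.interior_reindex, Affine.Simplex.interior_map,
        interior_eq_openTriangle hVi hVpos]
    · rw [Function.comp_apply, Equiv.swap_apply_self, hW]
  · have hS : S = (⟨_, hWi⟩ : Affine.Triangle ℝ (ℝ × ℝ)).map φ hφ.injective :=
      Affine.Simplex.ext fun j => (hW j).symm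
    refine ⟨W, hpos, ?_, ?_, Or.inl fun j => (hW j).symm⟩
    · rw [hS, Affine.Simplex.closedInterior_map, closedInterior_eq_closedTriangle hWi hpos]
    · rw [hS, Affine.Simplex.interior_map, interior_eq_openTriangle hWi hpos]

/-- Heron's formula in Eisenstein coordinates. -/
theorem three_mul_signedArea_sq (P Q S : ℝ × ℝ) :
    3 * signedArea P Q S ^ 2 = 4 * eisNorm (P - Q) * eisNorm (S - P)
      - (eisNorm (P - Q) + eisNorm (S - P) - eisNorm (Q - S)) ^ 2 := by
  simp only [signedArea, eisNorm, Prod.fst_sub, Prod.snd_sub]; ring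

theorem eisNorm_sub_comm (x y : ℝ × ℝ) : eisNorm (x - y) = eisNorm (y - x) := by
  rw [← eisNorm_neg, neg_sub]

/-- The vertices of the triangle with angles `α`, `2α`, `3β` in Eisenstein coordinates. -/
def targetVertices (a b M : ℝ) : Fin 3 → ℝ × ℝ :=
  ![(-(M * ((2 * b + a) * b)), 0), (M * (b ^ 2 + 2 * a * b), 0), (0, M * (a ^ 2 + 2 * a * b))]

theorem exists_similarity_target {a b c M l : ℝ} (ha : 0 < a) (hb : 0 < b) (hM : 0 < M)
    (hl : 0 < l) (hc : c ^ 2 = a ^ 2 + a * b + b ^ 2) {p : Fin 3 → Plane}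
    (h12 : dist (p 1) (p 2) = l * c ^ 2) (h20 : dist (p 2) (p 0) = l * ((2 * b + a) * c))
    (h01 : dist (p 0) (p 1) = l * (3 * b * (a + b))) :
    ∃ φ : ℝ × ℝ →ᵃ[ℝ] Plane, IsEisSimilarity φ (l / M) ∧ p = φ ∘ targetVertices a b M := by
  refine exists_isEisSimilarity ?_ (by positivity) ?_ ?_ ?_
  · have : (0 : ℝ) < M ^ 2 * (3 * b * (a + b)) * (a ^ 2 + 2 * a * b) := by positivity
    refine ne_of_gt ?_
    simp [signedArea, targetVertices]
    linarith
  · rw [h12, mul_pow, hc]; simp [eisNorm, targetVertices]; field_simp; ring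
  · rw [h20, mul_pow, mul_pow, hc]; simp [eisNorm, targetVertices]; field_simp; ring
  · rw [h01]; simp [eisNorm, targetVertices]; field_simp; ring

theorem PlaneTriangle.TilesInto.of_reindex {T R : PlaneTriangle} {N : ℕ} (e : Equiv.Perm (Fin 3))
    (h : PlaneTriangle.TilesInto (T.reindex e) R N) : PlaneTriangle.TilesInto T R N := by
  obtain ⟨S, h1, h2, h3⟩ := h
  exact ⟨S, h1, by rw [h2, Affine.Simplex.closedInterior_reindex], h3⟩

theorem PlaneTriangle.TilesInto.reindex {T R : PlaneTriangle} {N : ℕ} (e f : Equiv.Perm (Fin 3))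
    (h : PlaneTriangle.TilesInto T R N) :
    PlaneTriangle.TilesInto (T.reindex e) (R.reindex f) N := by
  obtain ⟨S, h1, h2, h3⟩ := h
  refine ⟨fun i => (S i).reindex f, fun i => (h1 i).index_map f.symm, ?_, fun i j hij => ?_⟩
  · simpa only [Affine.Simplex.closedInterior_reindex] using h2
  · simpa only [Affine.Simplex.interior_reindex] using h3 i j hij

theorem angle_eq_of_cos_eq {x y z : Plane} {θ u v w : ℝ} (h0 : 0 ≤ θ) (h1 : θ ≤ Real.pi)
    (hu : 0 < u) (hv : 0 < v) (hxy : dist x y = u) (hzy : dist z y = v) (hxz : dist x z = w)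
    (hcos : w ^ 2 = u ^ 2 + v ^ 2 - 2 * u * v * Real.cos θ) : ∠ x y z = θ := by
  refine Real.injOn_cos ⟨EuclideanGeometry.angle_nonneg _ _ _, EuclideanGeometry.angle_le_pi _ _ _⟩
    ⟨h0, h1⟩ ?_
  have h := EuclideanGeometry.law_cos x y z
  rw [hxy, hzy, hxz] at h
  have h2 : (2 * u * v) * Real.cos (∠ x y z) = (2 * u * v) * Real.cos θ := by linarith
  exact mul_left_cancel₀ (by positivity) h2

/-! ### Existence of a tiling, the number of tiles, and the theorem. -/

theorem exists_tiling {a b c : ℕ} (ha : 0 < a) (hb : 0 < b) (hcc : 0 < c)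
    (hc : (c : ℝ) ^ 2 = a ^ 2 + a * b + b ^ 2) {A B l : ℝ} (hA0 : 0 ≤ A) (hA1 : A ≤ Real.pi)
    (hB0 : 0 ≤ B) (hB1 : B ≤ Real.pi) (hA : 2 * c * Real.cos A = 2 * b + a)
    (hB : 2 * c * Real.cos B = 2 * a + b) (hl : 0 < l) {T : PlaneTriangle}
    (h12 : dist (T.points 1) (T.points 2) = l * c ^ 2)
    (h20 : dist (T.points 2) (T.points 0) = l * ((2 * b + a) * c))
    (h01 : dist (T.points 0) (T.points 1) = l * (3 * b * (a + b))) :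
    ∃ (R : PlaneTriangle) (γ : ℝ) (N : ℕ),
      PlaneTriangle.HasAngles R A B γ ∧ PlaneTriangle.TilesInto T R N := by
  have haR : (0 : ℝ) < a := by positivity
  have hbR : (0 : ℝ) < b := by positivity
  have hcR : (0 : ℝ) < c := by positivity
  obtain ⟨M, hM⟩ : ∃ M : ℕ, M = 3 * (a ^ 2 + b ^ 2) * a := ⟨_, rfl⟩
  have hM0 : (0 : ℝ) < M := by rw [hM]; positivity
  obtain ⟨φ, hφ, hT⟩ := exists_similarity_target haR hbR hM0 hl hc h12 h20 h01
  set k := l / M with hk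
  have hk0 : 0 < k := hφ.1
  have hVpos : 0 < signedArea (targetVertices a b M 0) (targetVertices a b M 1)
      (targetVertices a b M 2) := by
    have : (0 : ℝ) < M ^ 2 * (3 * b * (a + b)) * (a ^ 2 + 2 * a * b) := by positivity
    simp [signedArea, targetVertices]
    linarith
  have hRi : AffineIndependent ℝ (![(-(b : ℝ), 0), (0, (a : ℝ)), (0, 0)] : Fin 3 → ℝ × ℝ) := by
    rw [affineIndependent_iff_signedArea_ne_zero]
    simp [signedArea, ha.ne', hb.ne']
  set R : PlaneTriangle := (⟨_, hRi⟩ : Affine.Triangle ℝ (ℝ × ℝ)).map φ hφ.injective with hR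
  have r0 : dist (R.points 1) (R.points 2) = k * a :=
    hφ.dist_eq haR.le (by simp [eisNorm])
  have r1 : dist (R.points 2) (R.points 0) = k * b :=
    hφ.dist_eq hbR.le (by simp [eisNorm])
  have r2 : dist (R.points 0) (R.points 1) = k * c :=
    hφ.dist_eq hcR.le (by rw [hc]; simp [eisNorm]; ring)
  obtain ⟨N, hN⟩ := tilesInto_of_isTileable haR.le hbR.le hcR.le hφ hVpos hT r0 r1 r2
    (isTileable_target ha hb hcc hc hM)
  refine ⟨R, _, N, ⟨Equiv.refl _, ?_, ?_, rfl⟩, hN⟩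
  · change ∠ (R.points 1) (R.points 0) (R.points 2) = A
    refine angle_eq_of_cos_eq hA0 hA1 (mul_pos hk0 hcR) (mul_pos hk0 hbR)
      (by rw [dist_comm, r2]) r1 r0 ?_
    linear_combination (-k ^ 2) * hc + k ^ 2 * b * hA
  · change ∠ (R.points 2) (R.points 1) (R.points 0) = B
    refine angle_eq_of_cos_eq hB0 hB1 (mul_pos hk0 haR) (mul_pos hk0 hcR)
      (by rw [dist_comm, r0]) r2 r1 ?_
    linear_combination (-k ^ 2) * hc + k ^ 2 * a * hB

/-- With `r` the scale of the tile relative to the target, areas give `N r² = 3(a+b)(a+2b)`, and the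
base gives `3b(a+b) = r m` with `m` a natural number. Eliminating `r` leaves `s = m / (3b(a+b))`. -/
theorem card_of_tiling {a b c : ℕ} (ha : 0 < a) (hb : 0 < b)
    (hc : (c : ℝ) ^ 2 = a ^ 2 + a * b + b ^ 2) {l k : ℝ} (hl : 0 < l) (hk : 0 < k)
    {T R : PlaneTriangle} {N : ℕ}
    (h12 : dist (T.points 1) (T.points 2) = l * c ^ 2)
    (h20 : dist (T.points 2) (T.points 0) = l * ((2 * b + a) * c))
    (h01 : dist (T.points 0) (T.points 1) = l * (3 * b * (a + b)))
    (r12 : dist (R.points 1) (R.points 2) = k * a) (r20 : dist (R.points 2) (R.points 0) = k * b)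
    (r01 : dist (R.points 0) (R.points 1) = k * c) (h : PlaneTriangle.TilesInto T R N) :
    ∃ s : ℚ, s ≠ 0 ∧ (N : ℝ) = 3 * (a + b) * (a + 2 * b) * (s : ℝ) ^ 2 := by
  have haR : (0 : ℝ) < a := by positivity
  have hbR : (0 : ℝ) < b := by positivity
  obtain ⟨φ, hφ, hT⟩ := exists_similarity_target haR hbR one_pos hl hc h12 h20 h01
  rw [div_one] at hφ
  set V := targetVertices a b 1 with hVdef
  have hD : signedArea (V 0) (V 1) (V 2) = 3 * b * (a + b) * (a ^ 2 + 2 * a * b) := by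
    rw [hVdef]; simp [signedArea, targetVertices, -mul_eq_mul_left_iff, -mul_eq_mul_right_iff]; ring
  have hVpos : 0 < signedArea (V 0) (V 1) (V 2) := by rw [hD]; positivity
  have hTeq : T = (⟨V, (affineIndependent_iff_signedArea_ne_zero _).2 hVpos.ne'⟩ :
      Affine.Triangle ℝ (ℝ × ℝ)).map φ hφ.injective := Affine.Simplex.ext fun i => by
    rw [hT]; rfl
  obtain ⟨S, hcong, hU, hdisj⟩ := h
  choose W hW hWc hWo hWp using fun i => exists_coordinates hφ (S i)
  simp only [hWc] at hU
  rw [hTeq, Affine.Simplex.closedInterior_map, closedInterior_eq_closedTriangle _ hVpos,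
    ← Set.image_iUnion, hφ.injective.image_injective.eq_iff] at hU
  simp only [hWo, Set.disjoint_image_iff hφ.injective] at hdisj
  set r := k / l with hr
  have hr0 : 0 < r := div_pos hk hl
  have hnorm : ∀ {p q : ℝ × ℝ} {x : ℝ}, dist (φ p) (φ q) = k * x →
      eisNorm (p - q) = r ^ 2 * x ^ 2 := by
    intro p q x hx
    have h1 := hφ.2 p q
    rw [hx] at h1
    rw [hr]; field_simp
    linarith
  have hsides : ∀ i,
      (eisNorm (W i 1 - W i 2) = r ^ 2 * a ^ 2 ∧ eisNorm (W i 2 - W i 0) = r ^ 2 * b ^ 2 ∧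
        eisNorm (W i 0 - W i 1) = r ^ 2 * c ^ 2) ∨
      (eisNorm (W i 1 - W i 2) = r ^ 2 * a ^ 2 ∧ eisNorm (W i 2 - W i 0) = r ^ 2 * c ^ 2 ∧
        eisNorm (W i 0 - W i 1) = r ^ 2 * b ^ 2) := by
    intro i
    have d12 := ((hcong i).dist_eq 1 2).trans r12
    have d20 := ((hcong i).dist_eq 2 0).trans r20
    have d01 := ((hcong i).dist_eq 0 1).trans r01
    rcases hWp i with h | h
    · rw [h, h] at d12 d20 d01
      exact Or.inl ⟨hnorm d12, hnorm d20, hnorm d01⟩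
    · rw [h, h] at d12 d20 d01
      refine Or.inr ⟨?_, ?_, ?_⟩
      · rw [eisNorm_sub_comm]; exact hnorm d12
      · rw [eisNorm_sub_comm]; exact hnorm d01
      · rw [eisNorm_sub_comm]; exact hnorm d20
  have harea : ∀ i, signedArea (W i 0) (W i 1) (W i 2) = r ^ 2 * (a * b) := by
    intro i
    have h1 := three_mul_signedArea_sq (W i 0) (W i 1) (W i 2)
    refine (pow_left_inj₀ (hW i).le (by positivity) two_ne_zero).1 ?_
    rcases hsides i with ⟨e1, e2, e3⟩ | ⟨e1, e2, e3⟩ <;> rw [e1, e2, e3, hc] at h1 <;>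
      linear_combination h1 / 3
  have hsum := signedArea_eq_sum_of_tiling hVpos hW hU hdisj
  simp only [harea] at hsum
  rw [Finset.sum_const, Finset.card_univ, Fintype.card_fin, nsmul_eq_mul, hD] at hsum
  obtain ⟨f, hf, hside⟩ := side_eq_sum_of_tiling hVpos (by simp [hVdef, targetVertices])
    (by simp [hVdef, targetVertices]) hW hU hdisj (by
      have : (0 : ℝ) < a ^ 2 + 2 * a * b := by positivity
      simpa [hVdef, targetVertices] using! this)
  have hfn : ∀ i, ∃ n : ℕ, f i = r * n := by
    intro i
    obtain ⟨h0, h1⟩ := hf i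
    have key : ∀ n : ℕ, f i ^ 2 = r ^ 2 * (n : ℝ) ^ 2 → ∃ n : ℕ, f i = r * n := by
      intro n hn
      rw [← mul_pow] at hn
      exact ⟨n, (pow_left_inj₀ h0 (by positivity) two_ne_zero).1 hn⟩
    rcases h1 with h1 | h1
    · exact ⟨0, by simp [h1]⟩
    · rcases hsides i with ⟨e1, e2, e3⟩ | ⟨e1, e2, e3⟩ <;> rw [e1, e2, e3] at h1 <;>
        rcases h1 with h1 | h1 | h1 <;> exact key _ h1
  choose n hn using hfn
  have hside' : 3 * b * (a + b) = r * ((∑ i, n i : ℕ) : ℝ) := by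
    push_cast
    rw [Finset.mul_sum, ← Finset.sum_congr rfl fun i _ => hn i, ← hside]
    simp [hVdef, targetVertices]; ring
  generalize ∑ i, n i = m at hside'
  have hm0 : (m : ℝ) ≠ 0 := by
    intro h0
    rw [h0, mul_zero] at hside'
    have : (0 : ℝ) < 3 * b * (a + b) := by positivity
    linarith
  have hm0' : m ≠ 0 := by exact_mod_cast hm0
  refine ⟨m / (3 * b * (a + b)), ?_, ?_⟩
  · have : (0 : ℚ) < 3 * b * (a + b) := by positivity
    exact div_ne_zero (by exact_mod_cast hm0') this.ne'
  · push_cast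
    rw [hside']
    field_simp
    apply mul_left_cancel₀ (mul_pos haR hbR).ne'
    linear_combination hsum

theorem not_isSquare_of_eq {p q N : ℕ} (hp : 0 < p) (hpq : 3 * p < q) {s : ℚ} (hs : s ≠ 0)
    (h : (N : ℝ) = 6 * (q + 3 * p) * (q - p) * (q ^ 2 - 3 * p ^ 2) * (s : ℝ) ^ 2) :
    ¬ IsSquare N := by
  rintro ⟨w, rfl⟩
  have hp' : (0 : ℤ) < p := by exact_mod_cast hp
  have hpq' : 3 * (p : ℤ) < q := by exact_mod_cast hpq
  -- For these values `-m² + 6mn + 3n² = 8(q² - 3p²)`, so the form is `4w²/s²`; an integer that is a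
  -- rational square is a square.
  refine not_isSquare_three_mul_quartic (m := q + 3 * p) (n := q - p) (by linarith) (by linarith)
    (by nlinarith) ?_
  rw [← Rat.isSquare_intCast_iff]
  have h' : ((w * w : ℕ) : ℚ) = 6 * (q + 3 * p) * (q - p) * (q ^ 2 - 3 * p ^ 2) * s ^ 2 := by
    exact_mod_cast h
  refine ⟨2 * w / s, ?_⟩
  push_cast at h' ⊢
  field_simp
  linear_combination -4 * h'

theorem mainTheorem6 (T : PlaneTriangle) (A : ℝ)
    (hT : PlaneTriangle.HasAngles T A (2 * A) (Real.pi - 3 * A))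
    (hinc : ¬ PlaneTriangle.CommensurableAngles T)
    (hrat : ∃ q : ℚ, √3 * Real.tan (A / 2) = (q : ℝ)) :
    (∃ (R : PlaneTriangle) (β γ : ℝ) (N : ℕ),
      PlaneTriangle.HasAngles R A β γ ∧ A + β = Real.pi / 3 ∧
        PlaneTriangle.TilesInto T R N) ∧
    (∀ (R : PlaneTriangle) (β γ : ℝ) (N : ℕ),
      PlaneTriangle.HasAngles R A β γ → A + β = Real.pi / 3 →
        PlaneTriangle.TilesInto T R N →
          (∀ t : ℝ, t = Real.tan (A / 2) / √3 →
            ∃ r : ℚ, (N : ℝ) =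
              2 / 3 * ((3 * t ^ 2 - 1) / ((3 * t + 1) * (t - 1))) * (r : ℝ) ^ 2) ∧
          ¬ IsSquare N) := by
  obtain ⟨hA0, -, hA1, -, σ, κ, hκ, h12, h20, h01⟩ := hT.exists_sides
  obtain ⟨p, q, hp, hpq, htan, hsin, hcos⟩ := exists_parameters hA0 (by linarith) hrat
  have hpR : (0 : ℝ) < p := by positivity
  have hpqR : 3 * (p : ℝ) < q := by exact_mod_cast hpq
  have hs : √3 * √3 = (3 : ℝ) := Real.mul_self_sqrt (by norm_num)
  have hs3 : (0 : ℝ) < √3 := by positivity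
  -- Here `d + 1 = q - 3p`, which allows `b` to be defined without natural subtraction.
  obtain ⟨d, rfl⟩ := Nat.exists_eq_add_of_lt hpq
  set q := 3 * p + d + 1 with hq
  obtain ⟨a, ha⟩ : ∃ a : ℕ, a = 4 * p * q := ⟨_, rfl⟩
  obtain ⟨b, hb⟩ : ∃ b : ℕ, b = (d + 1) * (q + p) := ⟨_, rfl⟩
  obtain ⟨c, hc⟩ : ∃ c : ℕ, c = q ^ 2 + 3 * p ^ 2 := ⟨_, rfl⟩
  have hqd : (q : ℝ) = 3 * p + d + 1 := by rw [hq]; push_cast; ring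
  have haR : (a : ℝ) = 4 * p * q := by rw [ha]; push_cast; ring
  have hbR : (b : ℝ) = (q - 3 * p) * (q + p) := by rw [hb, hqd]; push_cast; rw [hqd]; ring
  have hcR : (c : ℝ) = q ^ 2 + 3 * p ^ 2 := by rw [hc]; push_cast; ring
  have ha0 : 0 < a := by rw [ha]; positivity
  have hb0 : 0 < b := by rw [hb]; positivity
  have hc0 : 0 < c := by rw [hc]; positivity
  have hc0R : (0 : ℝ) < c := by positivity
  have hccR : (c : ℝ) ^ 2 = a ^ 2 + a * b + b ^ 2 := by rw [haR, hbR, hcR]; ring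
  clear_value q
  have hsinA : 2 * c * Real.sin A = √3 * a := by rw [hsin, hcR, haR]; field_simp
  have hcosA : 2 * c * Real.cos A = 2 * b + a := by rw [hcos, hcR, haR, hbR]; field_simp; ring
  have hsinA' : Real.sin A = √3 * a / (2 * c) := by field_simp; linarith
  have hcosA' : Real.cos A = (2 * b + a) / (2 * c) := by field_simp; linarith
  have hcosB : 2 * c * Real.cos (Real.pi / 3 - A) = 2 * a + b := by
    rw [Real.cos_sub, Real.cos_pi_div_three, Real.sin_pi_div_three]
    linear_combination hcosA / 2 + √3 / 2 * hsinA + a / 2 * hs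
  have hsinB : Real.sin (Real.pi / 3 - A) = √3 * b / (2 * c) := by
    rw [Real.sin_sub, Real.cos_pi_div_three, Real.sin_pi_div_three, hsinA', hcosA']
    field_simp; ring
  -- The factor making the side `κ sin A = κ√3a/(2c)` equal to `l c²`.
  set l := κ * √3 * a / (2 * c ^ 3) with hl
  have hl0 : 0 < l := by positivity
  rw [Real.sin_pi_sub, Real.sin_three_mul] at h01
  rw [Real.sin_two_mul] at h20
  have g12 : dist (T.points (σ 1)) (T.points (σ 2)) = l * c ^ 2 := by
    rw [h12, hl, hsinA']; field_simp
  have g20 : dist (T.points (σ 2)) (T.points (σ 0)) = l * ((2 * b + a) * c) := by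
    rw [h20, hl, hsinA', hcosA']; field_simp
  have g01 : dist (T.points (σ 0)) (T.points (σ 1)) = l * (3 * b * (a + b)) := by
    have e : 3 * Real.sin A - 4 * Real.sin A ^ 3 = Real.sin A * (3 - 4 * Real.sin A ^ 2) := by ring
    have e2 : 3 - 4 * Real.sin A ^ 2 = 3 * b * (a + b) / c ^ 2 := by
      rw [hsinA']; field_simp
      linear_combination 12 * hccR - 4 * a ^ 2 * hs
    rw [h01, e, e2, hl, hsinA']; field_simp
  constructor
  · obtain ⟨R, γ, N, hR, hN⟩ := exists_tiling (T := T.reindex σ.symm) (A := A)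
      (B := Real.pi / 3 - A) ha0 hb0 hc0 hccR hA0.le (by linarith) (by linarith)
      (by linarith [Real.pi_pos]) hcosA hcosB hl0 g12 g20 g01
    exact ⟨R, _, γ, N, hR, by ring, hN.of_reindex _⟩
  · intro R β γ N hR hβ hN
    obtain ⟨-, -, -, hpi, τ, ρ, hρ, r12, r20, r01⟩ := hR.exists_sides
    have hβ' : β = Real.pi / 3 - A := by linarith
    have hγ : γ = Real.pi - Real.pi / 3 := by linarith
    rw [hβ', hsinB] at r20
    rw [hγ, Real.sin_pi_sub, Real.sin_pi_div_three] at r01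
    rw [hsinA'] at r12
    obtain ⟨s, hs0, hNs⟩ := card_of_tiling (T := T.reindex σ.symm) (R := R.reindex τ.symm)
      (k := ρ * √3 / (2 * c)) ha0 hb0 hccR hl0 (by positivity) g12 g20 g01
      (r12.trans (by field_simp)) (r20.trans (by field_simp)) (r01.trans (by field_simp))
      (hN.reindex _ _)
    have hNs' : (N : ℝ) = 6 * (q + 3 * p) * (q - p) * (q ^ 2 - 3 * p ^ 2) * (s : ℝ) ^ 2 := by
      rw [hNs, haR, hbR]; ring
    -- This `r` moves `(q+3p)(q-p)` into the denominator, and `6 = (2/3)·3²`.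
    refine ⟨fun t ht => ⟨3 * (q + 3 * p) * (q - p) * s, ?_⟩, not_isSquare_of_eq hp hpq hs0 hNs'⟩
    have hq0 : (0 : ℝ) < q := by linarith
    have ht' : t = p / q := by rw [ht, htan]; field_simp
    have e1 : (3 * t ^ 2 - 1) / ((3 * t + 1) * (t - 1)) =
        (q ^ 2 - 3 * p ^ 2) / ((q + 3 * p) * (q - p)) := by
      have n1 : (q : ℝ) - p ≠ 0 := by intro h; linarith
      have n2 : t - 1 ≠ 0 := by
        rw [ht']
        intro h
        field_simp at h
        exact n1 (by linarith)
      have n3 : 3 * t + 1 ≠ 0 := by rw [ht']; positivity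
      rw [div_eq_div_iff (mul_ne_zero n3 n2) (mul_ne_zero (by positivity) n1), ht']
      field_simp
      ring
    have n1 : (q : ℝ) - p ≠ 0 := by intro h; linarith
    rw [hNs', e1]
    push_cast
    field_simp
    ring
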